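/- Let $d\ge 1$. A finite set $S\subset\mathbb{R}^d$ is in general position if any at most $d+1$ of its points are affinely independent and no $d+2$ of its points lie on a common sphere. A triangulation of $S$ is a triangulation of the $d$-dimensional polytope $\operatorname{conv}(S)$ with vertices in $S$ (not necessarily all points of $S$ are vertices). It is regular if there is a convex function on $\operatorname{conv}(S)$ that is affine on each $d$-simplex of the triangulation and is given by different affine functions on different $d$-simplices. The parabolic functional is $$Vr(t)=\sum_{\Delta}\Big(\sum_{p\text{ vertex of }\Delta}\|p\|^2\Big)\operatorname{vol}(\Delta),$$ the outer sum being over all $d$-simplices $\Delta$ of $t$. A flip of $t$ replaces a subcomplex of $t$ that triangulates the convex hull of a set $Z$ of $d+2$ points, with vertices in $Z$, by a different triangulation of $Z$. A triangulation $t$ of $S$ is locally optimal if it is regular and no flip on $d+2$ points of $S$ turns it into a regular triangulation $t'$ of $S$ with $Vr(t')<Vr(t)$. The Delaunay triangulation $DT(S)$ is the straight-line dual of the Voronoi diagram: its $d$-simplices are spanned by those $d+1$ points of $S$ whose Voronoi cells have a common point. Incremental flip algorithm. Given distinct points $x_1,\dots,x_n$ and an artificial $d$-simplex with vertex set $S_0$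 containing them, such that the $x_i$ are not in $S_0$ and $S_0\cup\{x_1,\dots,x_n\}$ is in general position, put $S_i=S_0\cup\{x_1,\dots,x_i\}$. Start with the triangulation of $S_0$ consisting of the artificial simplex. For $i=1,\dots,n$, read the current triangulation as a triangulation of $S_i$; if it is not locally optimal, locate in it a $d$-simplex $s$ containing $x_i$ and flip the subcomplex on the vertices of $s$ and $x_i$; then, as long as there is a flip on $d+2$ points of $S_i$ that yields a regular triangulation of $S_i$ with smaller $Vr$, perform some such flip. (All choices are arbitrary.) The triangulation $LOT(S_i)$ is the current triangulation after round $i$. The output $LOT(S)$, $S=\{x_1,\dots,x_n\}$, consists of the $d$-simplices of $LOT(S_n)$ not incident to $S_0$. Theorem. (a) If $S$ is in general position, then every locally optimal triangulation of $S$ is the Delaunay triangulation of $S$. (b) In every run of the algorithm, all current triangulations are regular triangulations of the current point set, $Vr$ strictly decreases with each flip, the algorithm never gets stuck before it has completed round $n$, it terminates after finitely many steps, and $LOT(S_i)=DT(S_i)$ for $i=0,\dots,n$. (c) If $S=\{x_1,\dots,x_n\}$ (with distinct $x_i$) is in general position, then admissible artificial simplices exist with vertices arbitrarily far away, and there is an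 $R$ such that for every admissible artificial simplex with all vertices at distance more than $R$ from the origin the output $LOT(S)$ of every run of the algorithm is $DT(S)$. -/

import Mathlib

open scoped Classical

noncomputable section

namespace IncrementalFlip

/-- The ambient space `ℝ^d` with its Euclidean norm. -/
abbrev Pt (d : ℕ) : Type := EuclideanSpace ℝ (Fin d)

/-- A finite collection of `d`-simplices, each of them given by its set of vertices. Full-dimensional
triangulations are recorded by their `d`-simplices. -/
abbrev Cells (d : ℕ) : Type := Finset (Finset (Pt d))

/-- General position: at most `d + 1` of the points are always affinely independent, and no `d + 2`
of the points lie on a common sphere. -/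
structure GeneralPosition {d : ℕ} (S : Finset (Pt d)) : Prop where
  affineIndependent : ∀ T ⊆ S, T.card ≤ d + 1 →
    AffineIndependent ℝ (fun p : {p : Pt d // p ∈ T} => (p : Pt d))
  not_cospherical : ∀ T ⊆ S, T.card = d + 2 → ¬ EuclideanGeometry.Cospherical (T : Set (Pt d))

/-- `t` is a triangulation of the polytope `conv S` with vertices in `S` (not necessarily all of
them): the `d`-simplices of `t` cover `conv S` and any two of them meet in a common face. -/
structure IsTriangulation {d : ℕ} (S : Finset (Pt d)) (t : Cells d) : Prop where
  subset : ∀ T ∈ t, T ⊆ S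
  card_eq : ∀ T ∈ t, T.card = d + 1
  affineIndependent : ∀ T ∈ t, AffineIndependent ℝ (fun p : {p : Pt d // p ∈ T} => (p : Pt d))
  inter_eq : ∀ T ∈ t, ∀ T' ∈ t,
    convexHull ℝ (T : Set (Pt d)) ∩ convexHull ℝ (T' : Set (Pt d)) =
      convexHull ℝ ((T : Set (Pt d)) ∩ (T' : Set (Pt d)))
  cover : (⋃ T ∈ t, convexHull ℝ (T : Set (Pt d))) = convexHull ℝ (S : Set (Pt d))

/-- `t` is a regular triangulation of `S`: there is a convex function on `conv S` that is affine on
each `d`-simplex of `t` and is given by different affine functions on different simplices. -/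
def IsRegularTriangulation {d : ℕ} (S : Finset (Pt d)) (t : Cells d) : Prop :=
  IsTriangulation S t ∧
    ∃ (f : Pt d → ℝ) (g : Finset (Pt d) → (Pt d →ᵃ[ℝ] ℝ)),
      ConvexOn ℝ (convexHull ℝ (S : Set (Pt d))) f ∧
      (∀ T ∈ t, ∀ p ∈ convexHull ℝ (T : Set (Pt d)), f p = g T p) ∧
      (∀ T ∈ t, ∀ T' ∈ t, T ≠ T' → g T ≠ g T')

/-- The parabolic (Voronoi) functional: the sum over the `d`-simplices of the volume times the sum
of the squared norms of the vertices. -/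
def Vr {d : ℕ} (t : Cells d) : ℝ :=
  ∑ T ∈ t, (∑ p ∈ T, ‖p‖ ^ 2) * (MeasureTheory.volume (convexHull ℝ (T : Set (Pt d)))).toReal

/-- The Voronoi cell of `p` with respect to the points `S`. -/
def voronoiCell {d : ℕ} (S : Finset (Pt d)) (p : Pt d) : Set (Pt d) :=
  {c | ∀ q ∈ S, dist c p ≤ dist c q}

/-- The `d`-simplices of the Delaunay triangulation, the straight-line dual of the Voronoi diagram:
`d + 1` points of `S` span a simplex if their Voronoi cells have a point in common (which is then
the centre of a sphere through these points without points of `S` in its interior). -/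
def delaunay {d : ℕ} (S : Finset (Pt d)) : Cells d :=
  (S.powersetCard (d + 1)).filter fun T => ∃ c : Pt d, ∀ p ∈ T, c ∈ voronoiCell S p

/-- `t'` arises from `t` by the flip of the subcomplex of `t` that triangulates the convex hull of
the `d + 2` points `Z`: one triangulation of `Z` is replaced by a different one. -/
def IsFlip {d : ℕ} (Z : Finset (Pt d)) (t t' : Cells d) : Prop :=
  Z.card = d + 2 ∧ ∃ t₁ t₂ : Cells d, t₁ ⊆ t ∧ IsTriangulation Z t₁ ∧ IsTriangulation Z t₂ ∧
    t₁ ≠ t₂ ∧ t' = (t \ t₁) ∪ t₂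

/-- `t'` arises from the triangulation `t` of `S` by the flip of a non-optimal subcomplex: `t'` is
again a regular triangulation of `S`, and its parabolic functional is smaller. -/
def IsImprovingFlip {d : ℕ} (S : Finset (Pt d)) (t t' : Cells d) : Prop :=
  (∃ Z ⊆ S, IsFlip Z t t') ∧ IsRegularTriangulation S t' ∧ Vr t' < Vr t

/-- `t` is a locally optimal triangulation of `S`. -/
def IsLOT {d : ℕ} (S : Finset (Pt d)) (t : Cells d) : Prop :=
  IsRegularTriangulation S t ∧ ¬ ∃ t', IsImprovingFlip S t t'

/-- The set consisting of the artificial points `A` and the first `i` points `x 0, …, x (i - 1)`. -/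
def pointSet {d n : ℕ} (A : Finset (Pt d)) (x : Fin n → Pt d) (i : ℕ) : Finset (Pt d) :=
  A ∪ (Finset.univ.filter fun j : Fin n => (j : ℕ) < i).image x

/-- `A` is the vertex set of an artificial `d`-simplex containing the points `x`, and the points of
`A` together with the points `x` are distinct and in general position. -/
structure IsArtificialSimplex {d n : ℕ} (A : Finset (Pt d)) (x : Fin n → Pt d) : Prop where
  card_eq : A.card = d + 1
  mem_convexHull : ∀ j, x j ∈ convexHull ℝ (A : Set (Pt d))
  injective : Function.Injective x
  notMem : ∀ j, x j ∉ A
  generalPosition : GeneralPosition (pointSet A x n)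

/-- A state of the algorithm: the number `i` of points already treated, and the current
triangulation of the artificial points and the first `i` points. -/
structure State (d : ℕ) where
  i : ℕ
  tri : Cells d

/-- The initial state: the artificial simplex alone. -/
def initState {d : ℕ} (A : Finset (Pt d)) : State d := ⟨0, {A}⟩

/-- The while loop for the current point set has ended: there is no non-optimal subcomplex. -/
def LoopEnded {d n : ℕ} (A : Finset (Pt d)) (x : Fin n → Pt d) (c : State d) : Prop :=
  ¬ ∃ t', IsImprovingFlip (pointSet A x c.i) c.tri t'

/-- The steps of the algorithm in which a flip is performed, with arbitrary choices. -/
inductive FlipStep {d n : ℕ} (A : Finset (Pt d)) (x : Fin n → Pt d) : State d → State d → Prop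
  /-- The body of the while loop: flip some non-optimal subcomplex. -/
  | improve (i : ℕ) (t t' : Cells d) (h : IsImprovingFlip (pointSet A x i) t t') :
      FlipStep A x ⟨i, t⟩ ⟨i, t'⟩
  /-- The loop has ended and the next point is taken. The current triangulation, read as a
  triangulation of the enlarged point set, is not locally optimal: locate a simplex `s` that
  contains the new point and flip the subcomplex on `s` and the new point. -/
  | insert (j : Fin n) (t t' : Cells d) (s : Finset (Pt d))
      (hend : LoopEnded A x ⟨j, t⟩) (hnot : ¬ IsLOT (pointSet A x (j + 1)) t)
      (hs : s ∈ t) (hx : x j ∈ convexHull ℝ (s : Set (Pt d)))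
      (hflip : IsFlip (Insert.insert (x j) s) t t') :
      FlipStep A x ⟨j, t⟩ ⟨j + 1, t'⟩

/-- The steps of the algorithm: a flip, or the passage to the next point without a flip if the
current triangulation is locally optimal also for the enlarged point set. -/
inductive Step {d n : ℕ} (A : Finset (Pt d)) (x : Fin n → Pt d) : State d → State d → Prop
  | flip (c c' : State d) (h : FlipStep A x c c') : Step A x c c'
  | skip (j : Fin n) (t : Cells d) (hend : LoopEnded A x ⟨j, t⟩)
      (hlot : IsLOT (pointSet A x (j + 1)) t) : Step A x ⟨j, t⟩ ⟨j + 1, t⟩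

/-- The state `c` occurs in some run of the algorithm. -/
def Reachable {d n : ℕ} (A : Finset (Pt d)) (x : Fin n → Pt d) (c : State d) : Prop :=
  Relation.ReflTransGen (Step A x) (initState A) c

/-- The algorithm stops regularly in the state `c`: all points have been treated, and the last while
loop has ended. -/
def IsFinal {d n : ℕ} (A : Finset (Pt d)) (x : Fin n → Pt d) (c : State d) : Prop :=
  c.i = n ∧ LoopEnded A x c

/-- The output of the algorithm: the simplices of `t` that are not incident to an artificial
point. -/
def output {d : ℕ} (A : Finset (Pt d)) (t : Cells d) : Cells d :=
  t.filter fun T => Disjoint T A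

end IncrementalFlip

end

/-!
A triangulation is regular exactly if its simplices are *lower cells* for some weights `w`: lift
each `p ∈ S` to height `w p`, and ask that the hyperplane through the lifted vertices of a simplex
lies strictly below all other lifted points (`IsRegularTriangulation.exists_weights`,
`isRegularTriangulation_of_isLowerCell`). Lower cells that cover `conv S` are all the lower cells
(`mem_of_isLowerCell`), and the lower cells for the weights `‖p‖ ^ 2` are the Delaunay simplices
(`mem_delaunay_iff`).

*Locally optimal triangulations are Delaunay.* Start with weights `w` of a regular triangulation
`t`, perturbed to be generic, and move them linearly to `‖p‖ ^ 2`. If some simplex of `t` is not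
Delaunay, then `t` stops being the lower hull at a first time, and by genericity the reason is that
the lifted points of a single set `Z` of `d + 2` points become coplanar. The affine dependence `l`
of `Z` (a circuit) has two triangulations, by the simplices opposite to the points with positive and
with negative coefficients. The expression `∑ l z * w z` changes its sign at that time, which means
that `t` is flipped on `Z` from the first triangulation to the second one and remains regular. As
the expression is linear in the weights and changes its sign only once, it is negative for
`‖p‖ ^ 2`. The volumes of the simplices spanned by `d + 1` points of `Z` are proportional to `|l|`
(`IsCircuit.exists_hullVolume`), so that the difference of the two values of `Vr` is a positive
multiple of `∑ l z * ‖z‖ ^ 2`, and the flip is improving (`exists_isImprovingFlip`).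

*The algorithm.* A new point `x` in a simplex `s` of `t` can be lifted slightly below the lifted
simplex. Hence the subdivision of `s` at `x` is regular, and it is the only flip on `s` and `x`
(`IsInsertion.eq_of_isFlip`); it decreases `Vr` since `‖x‖ ^ 2` is convex. Runs are finite because
there are only finitely many sets of simplices with vertices in a finite set.

*Artificial points far away.* They exist since the points that violate general position form a null
set, and a small perturbation of a large simplex still contains a large ball. If they lie outside
the circumscribed balls of the finitely many Delaunay simplices of `S`, then these simplices remain
Delaunay when the artificial points are added (`exists_radius_output_eq`).
-/

namespace IncrementalFlip

open Finset Filter Topology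

variable {d : ℕ}

/-! ### Barycentric coordinates and affine interpolation -/

/-- `T` is the vertex set of a nondegenerate `d`-simplex. -/
structure IsSimplex (T : Finset (Pt d)) : Prop where
  card_eq : T.card = d + 1
  affineIndependent : AffineIndependent ℝ (fun p : {p : Pt d // p ∈ T} => (p : Pt d))

lemma IsSimplex.affineSpan_eq_top {T : Finset (Pt d)} (hT : IsSimplex T) :
    affineSpan ℝ (T : Set (Pt d)) = ⊤ := by
  have h := (hT.affineIndependent.affineSpan_eq_top_iff_card_eq_finrank_add_one).2 (by
    simp [hT.card_eq])
  simpa using h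

lemma IsSimplex.nonempty {T : Finset (Pt d)} (hT : IsSimplex T) : T.Nonempty := by
  rw [← Finset.card_pos, hT.card_eq]; omega

lemma IsSimplex.interior_nonempty {T : Finset (Pt d)} (hT : IsSimplex T) :
    (interior (convexHull ℝ (T : Set (Pt d)))).Nonempty :=
  interior_convexHull_nonempty_iff_affineSpan_eq_top.2 hT.affineSpan_eq_top

lemma IsSimplex.exists_bary {T : Finset (Pt d)} (hT : IsSimplex T) :
    ∃ b : Pt d → (Pt d →ᵃ[ℝ] ℝ), (∀ p ∈ T, ∀ q ∈ T, b p q = if p = q then 1 else 0) ∧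
      (∀ x, ∑ p ∈ T, b p x = 1) ∧ ∀ x, ∑ p ∈ T, b p x • p = x := by
  let B : AffineBasis {p : Pt d // p ∈ T} ℝ (Pt d) :=
    ⟨fun p => (p : Pt d), hT.affineIndependent, by simpa using hT.affineSpan_eq_top⟩
  refine ⟨fun p => if h : p ∈ T then B.coord ⟨p, h⟩ else 0, ?_, ?_, ?_⟩
  · intro p hp q hq
    simp only [hp, dif_pos]
    have := B.coord_apply ⟨p, hp⟩ ⟨q, hq⟩
    simp only [Subtype.mk.injEq] at this
    convert! this
  · intro x
    rw [← Finset.sum_coe_sort]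
    simpa using B.sum_coord_apply_eq_one x
  · intro x
    rw [← Finset.sum_coe_sort]
    simpa using! B.linear_combination_coord_eq_self x

/-- The barycentric coordinate of the vertex `p` with respect to the simplex `T`, as an affine
function on the whole space; it is zero if `T` is not a simplex. -/
noncomputable def bary (T : Finset (Pt d)) : Pt d → (Pt d →ᵃ[ℝ] ℝ) :=
  if h : IsSimplex T then h.exists_bary.choose else 0

/-- The affine function that takes the values `w` at the vertices of the simplex `T`. -/
noncomputable def interp (T : Finset (Pt d)) (w : Pt d → ℝ) : Pt d →ᵃ[ℝ] ℝ :=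
  ∑ p ∈ T, w p • bary T p

lemma interp_apply (T : Finset (Pt d)) (w : Pt d → ℝ) (x : Pt d) :
    interp T w x = ∑ p ∈ T, w p * bary T p x := by
  have : ∀ (s : Finset (Pt d)) (f : Pt d → (Pt d →ᵃ[ℝ] ℝ)), (∑ p ∈ s, f p) x = ∑ p ∈ s, f p x := by
    intro s f
    induction s using Finset.induction_on with
    | empty => simp
    | insert a s ha ih =>
      rw [Finset.sum_insert ha, Finset.sum_insert ha, ← ih, AffineMap.coe_add, Pi.add_apply]
  rw [interp, this]
  simp

lemma interp_add_smul (T : Finset (Pt d)) (w v : Pt d → ℝ) (s : ℝ) (x : Pt d) :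
    interp T (w + s • v) x = interp T w x + s * interp T v x := by
  simp only [interp_apply, Finset.mul_sum, ← Finset.sum_add_distrib]
  refine Finset.sum_congr rfl fun p _ => ?_
  simp only [Pi.add_apply, Pi.smul_apply, smul_eq_mul]; ring

lemma interp_congr {T : Finset (Pt d)} {w v : Pt d → ℝ} (h : ∀ p ∈ T, w p = v p) :
    interp T w = interp T v :=
  Finset.sum_congr rfl fun p hp => by rw [h p hp]

namespace IsSimplex

variable {T : Finset (Pt d)} (hT : IsSimplex T)
include hT

lemma bary_apply {p q : Pt d} (hp : p ∈ T) (hq : q ∈ T) :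
    bary T p q = if p = q then 1 else 0 := by
  rw [bary, dif_pos hT]
  exact hT.exists_bary.choose_spec.1 p hp q hq

lemma bary_self {p : Pt d} (hp : p ∈ T) : bary T p p = 1 := by
  rw [hT.bary_apply hp hp, if_pos rfl]

lemma bary_of_ne {p q : Pt d} (hp : p ∈ T) (hq : q ∈ T) (h : p ≠ q) : bary T p q = 0 := by
  rw [hT.bary_apply hp hq, if_neg h]

lemma sum_bary (x : Pt d) : ∑ p ∈ T, bary T p x = 1 := by
  rw [bary, dif_pos hT]
  exact hT.exists_bary.choose_spec.2.1 x

lemma sum_bary_smul (x : Pt d) : ∑ p ∈ T, bary T p x • p = x := by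
  rw [bary, dif_pos hT]
  exact hT.exists_bary.choose_spec.2.2 x

lemma interp_of_mem (w : Pt d → ℝ) {q : Pt d} (hq : q ∈ T) : interp T w q = w q := by
  rw [interp_apply, Finset.sum_eq_single q]
  · rw [hT.bary_self hq, mul_one]
  · intro p hp hpq
    rw [hT.bary_of_ne hp hq hpq, mul_zero]
  · exact fun h => absurd hq h

end IsSimplex

lemma affine_sum (g : Pt d →ᵃ[ℝ] ℝ) (T : Finset (Pt d)) (μ : Pt d → ℝ) (h : ∑ p ∈ T, μ p = 1) :
    g (∑ p ∈ T, μ p • p) = ∑ p ∈ T, μ p * g p := by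
  have hg : ∀ x, g x = g.linear x + g 0 := fun x => by
    have := g.decomp
    exact congrFun this x
  rw [hg, map_sum]
  simp only [map_smul, smul_eq_mul]
  have : ∀ p ∈ T, μ p * g p = μ p * g.linear p + μ p * g 0 := fun p _ => by rw [hg p]; ring
  rw [Finset.sum_congr rfl this, Finset.sum_add_distrib, ← Finset.sum_mul, h, one_mul]

lemma IsSimplex.apply_eq_sum {T : Finset (Pt d)} (hT : IsSimplex T) (g : Pt d →ᵃ[ℝ] ℝ) (x : Pt d) :
    g x = ∑ p ∈ T, bary T p x * g p := by
  conv_lhs => rw [← hT.sum_bary_smul x]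
  exact affine_sum g T _ (hT.sum_bary x)

lemma IsSimplex.affine_ext {T : Finset (Pt d)} (hT : IsSimplex T) {g g' : Pt d →ᵃ[ℝ] ℝ}
    (h : ∀ p ∈ T, g p = g' p) : g = g' := by
  ext x
  rw [hT.apply_eq_sum g, hT.apply_eq_sum g']
  exact Finset.sum_congr rfl fun p hp => by rw [h p hp]

lemma IsSimplex.interp_eq {T : Finset (Pt d)} (hT : IsSimplex T) {w : Pt d → ℝ} {g : Pt d →ᵃ[ℝ] ℝ}
    (h : ∀ p ∈ T, g p = w p) : interp T w = g :=
  hT.affine_ext fun p hp => by rw [hT.interp_of_mem w hp, h p hp]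

/-- A barycentric coordinate vanishes on the faces that do not contain its vertex. -/
lemma IsSimplex.bary_eq_zero {T : Finset (Pt d)} (hT : IsSimplex T) {F : Set (Pt d)} {p x : Pt d}
    (hF : F ⊆ T) (hp : p ∈ T) (hpF : p ∉ F) (hx : x ∈ convexHull ℝ F) : bary T p x = 0 := by
  have : convexHull ℝ F ⊆ (bary T p) ⁻¹' {0} := by
    refine convexHull_min ?_ ((convex_singleton (0 : ℝ)).affine_preimage _)
    intro q hq
    exact hT.bary_of_ne hp (hF hq) (fun h => hpF (h ▸ hq))
  exact this hx

lemma IsSimplex.mem_convexHull_iff {T : Finset (Pt d)} (hT : IsSimplex T) {x : Pt d} :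
    x ∈ convexHull ℝ (T : Set (Pt d)) ↔ ∀ p ∈ T, 0 ≤ bary T p x := by
  constructor
  · intro hx p hp
    have : convexHull ℝ (T : Set (Pt d)) ⊆ (bary T p) ⁻¹' Set.Ici 0 := by
      refine convexHull_min ?_ ((convex_Ici (0 : ℝ)).affine_preimage _)
      intro q hq
      simp only [Set.mem_preimage, Set.mem_Ici]
      rw [hT.bary_apply hp hq]
      split_ifs <;> norm_num
    exact this hx
  · intro h
    rw [Finset.mem_convexHull']
    exact ⟨fun p => bary T p x, h, hT.sum_bary x, hT.sum_bary_smul x⟩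

lemma affine_le_of_le (g g' : Pt d →ᵃ[ℝ] ℝ) (F : Set (Pt d)) (h : ∀ p ∈ F, g p ≤ g' p) {x : Pt d}
    (hx : x ∈ convexHull ℝ F) : g x ≤ g' x := by
  have : convexHull ℝ F ⊆ (g' - g) ⁻¹' Set.Ici 0 := by
    refine convexHull_min ?_ ((convex_Ici (0 : ℝ)).affine_preimage _)
    intro q hq
    simpa using h q hq
  simpa using this hx

/-! ### Lower cells of a weighted point set -/

/-- The `d`-simplices that appear in the lower convex hull of `S` lifted to the heights `w`: the
affine function through the lifted vertices is strictly below the other lifted points. -/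
structure IsLowerCell (S : Finset (Pt d)) (w : Pt d → ℝ) (T : Finset (Pt d)) : Prop
    extends IsSimplex T where
  subset : T ⊆ S
  lt : ∀ q ∈ S, q ∉ T → interp T w q < w q

namespace IsLowerCell

variable {S T T' : Finset (Pt d)} {w : Pt d → ℝ}

lemma interp_le (hT : IsLowerCell S w T) {q : Pt d} (hq : q ∈ S) : interp T w q ≤ w q := by
  by_cases h : q ∈ T
  · rw [hT.interp_of_mem w h]
  · exact (hT.lt q hq h).le

lemma interp_le_interp (hT : IsLowerCell S w T) (hT' : IsLowerCell S w T') {x : Pt d}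
    (hx : x ∈ convexHull ℝ (T : Set (Pt d))) : interp T' w x ≤ interp T w x :=
  affine_le_of_le _ _ _ (fun p hp => by
    rw [hT.interp_of_mem w hp]; exact hT'.interp_le (hT.subset hp)) hx

/-- A point of a lower cell at which the affine function of another one has the same value lies
in the common face. -/
lemma mem_of_interp_eq (hT : IsLowerCell S w T) (hT' : IsLowerCell S w T') {x : Pt d}
    (hx : x ∈ convexHull ℝ (T : Set (Pt d))) (h : interp T' w x = interp T w x) :
    x ∈ convexHull ℝ ((T : Set (Pt d)) ∩ T') := by
  have hx' := hT.mem_convexHull_iff.1 hx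
  have key : ∀ p ∈ T, p ∉ T' → bary T p x = 0 := by
    intro p hp hpT'
    by_contra hne
    have hpos : 0 < bary T p x := lt_of_le_of_ne (hx' p hp) (Ne.symm hne)
    have : interp T' w x < interp T w x := by
      rw [hT.apply_eq_sum (interp T' w), hT.apply_eq_sum (interp T w)]
      refine Finset.sum_lt_sum (fun r hr => ?_) ⟨p, hp, ?_⟩
      · rw [hT.interp_of_mem w hr]
        exact mul_le_mul_of_nonneg_left (hT'.interp_le (hT.subset hr)) (hx' r hr)
      · rw [hT.interp_of_mem w hp]
        exact mul_lt_mul_of_pos_left (hT'.lt p (hT.subset hp) hpT') hpos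
    exact this.ne h
  rw [← Finset.coe_inter, Finset.mem_convexHull']
  refine ⟨fun p => bary T p x, fun p hp => hx' p (Finset.mem_inter.1 hp).1, ?_, ?_⟩
  · rw [← hT.sum_bary x]
    refine Finset.sum_subset Finset.inter_subset_left fun p hp hp' => key p hp fun h => hp' ?_
    exact Finset.mem_inter.2 ⟨hp, h⟩
  · conv_rhs => rw [← hT.sum_bary_smul x]
    refine Finset.sum_subset Finset.inter_subset_left fun p hp hp' => ?_
    simp only [key p hp fun h => hp' (Finset.mem_inter.2 ⟨hp, h⟩), zero_smul]

lemma inter_eq (hT : IsLowerCell S w T) (hT' : IsLowerCell S w T') :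
    convexHull ℝ (T : Set (Pt d)) ∩ convexHull ℝ (T' : Set (Pt d)) =
      convexHull ℝ ((T : Set (Pt d)) ∩ (T' : Set (Pt d))) := by
  refine Set.Subset.antisymm ?_ ?_
  · rintro x ⟨hx, hx'⟩
    exact hT.mem_of_interp_eq hT' hx (le_antisymm (hT.interp_le_interp hT' hx)
      (hT'.interp_le_interp hT hx'))
  · exact Set.subset_inter (convexHull_mono Set.inter_subset_left)
      (convexHull_mono Set.inter_subset_right)

lemma eq_of_interp_eq (hT : IsLowerCell S w T) (hT' : IsLowerCell S w T')
    (h : interp T w = interp T' w) : T = T' := by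
  refine Finset.eq_of_subset_of_card_le (fun p hp => ?_) (by rw [hT.card_eq, hT'.card_eq])
  by_contra hp'
  have := hT'.lt p (hT.subset hp) hp'
  rw [← h, hT.interp_of_mem w hp] at this
  exact this.false

end IsLowerCell

/-- A simplex has a point, for example its centroid, that lies in no proper face. -/
lemma IsSimplex.exists_forall_mem {T : Finset (Pt d)} (hT : IsSimplex T) :
    ∃ x ∈ convexHull ℝ (T : Set (Pt d)), ∀ F : Set (Pt d), F ⊆ T → x ∈ convexHull ℝ F →
      (T : Set (Pt d)) ⊆ F := by
  have hc : (0 : ℝ) < T.card := by exact_mod_cast Finset.card_pos.2 hT.nonempty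
  have hsum : ∑ _p ∈ T, (T.card : ℝ)⁻¹ = 1 := by
    rw [Finset.sum_const, nsmul_eq_mul, mul_inv_cancel₀ hc.ne']
  refine ⟨∑ p ∈ T, (T.card : ℝ)⁻¹ • p, ?_, ?_⟩
  · rw [Finset.mem_convexHull']
    exact ⟨fun _ => (T.card : ℝ)⁻¹, fun p _ => (inv_pos.2 hc).le, hsum, rfl⟩
  · intro F hF hx p hp
    by_contra hpF
    have h0 := hT.bary_eq_zero hF hp hpF hx
    rw [affine_sum _ _ _ hsum, Finset.sum_eq_single p, hT.bary_self hp] at h0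
    · have := inv_pos.2 hc
      linarith
    · intro q hq hqp
      rw [hT.bary_of_ne hp hq (Ne.symm hqp), mul_zero]
    · exact fun h => absurd hp h

/-- Lower cells that cover the convex hull are all the lower cells. -/
lemma mem_of_isLowerCell {S : Finset (Pt d)} {w : Pt d → ℝ} {t : Cells d}
    (ht : ∀ T ∈ t, IsLowerCell S w T)
    (hcover : convexHull ℝ (S : Set (Pt d)) ⊆ ⋃ T ∈ t, convexHull ℝ (T : Set (Pt d)))
    {T : Finset (Pt d)} (hT : IsLowerCell S w T) : T ∈ t := by
  obtain ⟨x, hx, hmin⟩ := hT.exists_forall_mem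
  have := hcover (convexHull_mono (Finset.coe_subset.2 hT.subset) hx)
  simp only [Set.mem_iUnion] at this
  obtain ⟨T', hT't, hxT'⟩ := this
  have hT' := ht T' hT't
  have h2 : x ∈ convexHull ℝ ((T : Set (Pt d)) ∩ T') := by
    rw [← hT.inter_eq hT']; exact ⟨hx, hxT'⟩
  have h3 : T ⊆ T' := fun p hp => (hmin _ Set.inter_subset_left h2 hp).2
  rwa [Finset.eq_of_subset_of_card_le h3 (by rw [hT.card_eq, hT'.card_eq])]

lemma isRegularTriangulation_of_isLowerCell {S : Finset (Pt d)} {w : Pt d → ℝ} {t : Cells d}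
    (ht : ∀ T ∈ t, IsLowerCell S w T)
    (hcover : convexHull ℝ (S : Set (Pt d)) ⊆ ⋃ T ∈ t, convexHull ℝ (T : Set (Pt d))) :
    IsRegularTriangulation S t := by
  refine ⟨⟨fun T hT => (ht T hT).subset, fun T hT => (ht T hT).card_eq,
    fun T hT => (ht T hT).affineIndependent, fun T hT T' hT' => (ht T hT).inter_eq (ht T' hT'),
    Set.Subset.antisymm (Set.iUnion₂_subset fun T hT =>
      convexHull_mono (Finset.coe_subset.2 (ht T hT).subset)) hcover⟩, ?_⟩
  rcases t.eq_empty_or_nonempty with rfl | hne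
  · exact ⟨fun _ => 0, fun _ => 0, convexOn_const _ (convex_convexHull ℝ _), by simp, by simp⟩
  · refine ⟨fun x => t.sup' hne fun T => interp T w x, fun T => interp T w, ?_, ?_, ?_⟩
    · refine ⟨convex_convexHull ℝ _, fun x _ y _ a b ha hb hab => ?_⟩
      refine Finset.sup'_le _ _ fun T hT => ?_
      rw [Convex.combo_affine_apply hab]
      simp only [smul_eq_mul]
      gcongr
      · exact Finset.le_sup' (fun T => interp T w x) hT
      · exact Finset.le_sup' (fun T => interp T w y) hT
    · intro T hT p hp
      exact le_antisymm (Finset.sup'_le _ _ fun T' hT' => (ht T hT).interp_le_interp (ht T' hT') hp)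
        (Finset.le_sup' (fun T => interp T w p) hT)
    · intro T hT T' hT' hne h
      exact hne ((ht T hT).eq_of_interp_eq (ht T' hT') h)

/-! ### Regular triangulations consist of lower cells -/

/-- Moving a little from an interior point of a set towards any point does not leave the set. -/
lemma exists_combo_mem {K : Set (Pt d)} {c : Pt d} (hc : c ∈ interior K) (y : Pt d) :
    ∃ δ : ℝ, 0 < δ ∧ δ < 1 ∧ (1 - δ) • c + δ • y ∈ K := by
  have hcont : Continuous fun δ : ℝ => (1 - δ) • c + δ • y := by fun_prop
  have h0 : (fun δ : ℝ => (1 - δ) • c + δ • y) 0 ∈ interior K := by simpa using hc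
  have h1 : ∀ᶠ δ in nhdsWithin (0 : ℝ) (Set.Ioi 0), (1 - δ) • c + δ • y ∈ interior K :=
    (hcont.continuousAt.eventually_mem (isOpen_interior.mem_nhds h0)).filter_mono nhdsWithin_le_nhds
  have h2 : ∀ᶠ δ in nhdsWithin (0 : ℝ) (Set.Ioi 0), δ ∈ Set.Ioo (0 : ℝ) 1 :=
    Ioo_mem_nhdsGT one_pos
  obtain ⟨δ, hδ, hδ'⟩ := (h1.and h2).exists
  exact ⟨δ, hδ'.1, hδ'.2, interior_subset hδ⟩

lemma affine_combo (g : Pt d →ᵃ[ℝ] ℝ) (x y : Pt d) (a : ℝ) :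
    g ((1 - a) • x + a • y) = (1 - a) * g x + a * g y := by
  simpa using Convex.combo_affine_apply (f := g) (x := x) (y := y) (sub_add_cancel 1 a)

/-- A convex function that is affine on a set with nonempty interior lies above the affine
function everywhere. -/
lemma affine_le_of_convexOn {C K : Set (Pt d)} {f : Pt d → ℝ} (hf : ConvexOn ℝ C f)
    (g : Pt d →ᵃ[ℝ] ℝ) (hKC : K ⊆ C) (hfg : ∀ p ∈ K, f p = g p) {c : Pt d} (hc : c ∈ interior K)
    {y : Pt d} (hy : y ∈ C) : g y ≤ f y := by
  obtain ⟨δ, h0, h1, hmem⟩ := exists_combo_mem hc y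
  have h := hf.2 (hKC (interior_subset hc)) hy (sub_nonneg.2 h1.le) h0.le (sub_add_cancel 1 δ)
  rw [hfg _ hmem, affine_combo, hfg c (interior_subset hc)] at h
  simp only [smul_eq_mul] at h
  exact le_of_mul_le_mul_left (by linarith) h0

/-- The convex function of a regular triangulation is strictly above the affine function of a
simplex `T` at the vertices outside `T`: if they agreed at `q`, the convex function would be given
by the same affine function on a simplex that meets the hull of `T` and `q` outside `T`. -/
lemma affine_lt_of_regular {S : Finset (Pt d)} {t : Cells d} (ht : IsTriangulation S t)
    {f : Pt d → ℝ} {g : Finset (Pt d) → (Pt d →ᵃ[ℝ] ℝ)}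
    (hf : ConvexOn ℝ (convexHull ℝ (S : Set (Pt d))) f)
    (hfg : ∀ T ∈ t, ∀ p ∈ convexHull ℝ (T : Set (Pt d)), f p = g T p)
    (hne : ∀ T ∈ t, ∀ T' ∈ t, T ≠ T' → g T ≠ g T') {T : Finset (Pt d)} (hT : T ∈ t)
    {q : Pt d} (hq : q ∈ convexHull ℝ (S : Set (Pt d)))
    (hqT : q ∉ convexHull ℝ (T : Set (Pt d))) : g T q < f q := by
  have hsub : ∀ T ∈ t, convexHull ℝ (T : Set (Pt d)) ⊆ convexHull ℝ (S : Set (Pt d)) :=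
    fun T hT => convexHull_mono (Finset.coe_subset.2 (ht.subset T hT))
  obtain ⟨c, hc⟩ := (IsSimplex.mk (ht.card_eq T hT) (ht.affineIndependent T hT)).interior_nonempty
  have hle : ∀ y ∈ convexHull ℝ (S : Set (Pt d)), g T y ≤ f y := fun y hy =>
    affine_le_of_convexOn hf (g T) (hsub T hT) (hfg T hT) hc hy
  refine lt_of_le_of_ne (hle q hq) fun heq => ?_
  have hclosed : IsClosed (convexHull ℝ (T : Set (Pt d))) :=
    T.finite_toSet.isClosed_convexHull ℝ
  have hqint : q ∈ interior (convexHull ℝ (T : Set (Pt d)))ᶜ := by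
    rw [hclosed.isOpen_compl.interior_eq]; exact hqT
  obtain ⟨τ, hτ0, hτ1, hy⟩ := exists_combo_mem hqint c
  -- On the segments from `q` to points of the simplex `T`, the convex function is affine.
  have hseg : ∀ c' ∈ convexHull ℝ (T : Set (Pt d)),
      f ((1 - τ) • q + τ • c') = g T ((1 - τ) • q + τ • c') := by
    intro c' hc'
    refine le_antisymm ?_ (hle _ ((convex_convexHull ℝ _) hq (hsub T hT hc')
      (sub_nonneg.2 hτ1.le) hτ0.le (sub_add_cancel 1 τ)))
    have h := hf.2 hq (hsub T hT hc') (sub_nonneg.2 hτ1.le) hτ0.le (sub_add_cancel 1 τ)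
    rw [affine_combo]
    rw [← heq, hfg T hT c' hc'] at h
    simpa using h
  set y : Pt d := (1 - τ) • q + τ • c with hydef
  have hyS : y ∈ convexHull ℝ (S : Set (Pt d)) := (convex_convexHull ℝ _) hq
    (hsub T hT (interior_subset hc)) (sub_nonneg.2 hτ1.le) hτ0.le (sub_add_cancel 1 τ)
  have hfy : f y = g T y := hseg c (interior_subset hc)
  rw [← ht.cover] at hyS
  simp only [Set.mem_iUnion] at hyS
  obtain ⟨T', hT', hyT'⟩ := hyS
  have hTT' : T ≠ T' := fun h => hy (h ▸ hyT')
  refine hne T hT T' hT' hTT' (IsSimplex.affine_ext ⟨ht.card_eq T' hT', ht.affineIndependent T' hT'⟩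
    fun v hv => ?_)
  obtain ⟨δ, hδ0, hδ1, hδ⟩ := exists_combo_mem hc (c + v - y)
  have hz : (1 - τ) • q + τ • ((1 - δ) • c + δ • (c + v - y)) = (1 - τ * δ) • y + (τ * δ) • v := by
    rw [hydef]; module
  have h1 := hseg _ hδ
  have hτδ : τ * δ < 1 := by nlinarith
  have h2 := hfg T' hT' _ ((convex_convexHull ℝ _) hyT' (subset_convexHull ℝ _ hv)
    (sub_nonneg.2 hτδ.le) (mul_pos hτ0 hδ0).le (sub_add_cancel 1 (τ * δ)))
  rw [hz] at h1
  rw [h1, affine_combo (g T) y, affine_combo (g T') y, ← hfy, hfg T' hT' y hyT'] at h2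
  exact mul_left_cancel₀ (mul_pos hτ0 hδ0).ne' (add_left_cancel h2)

lemma IsRegularTriangulation.exists_weights {S : Finset (Pt d)} {t : Cells d}
    (h : IsRegularTriangulation S t) : ∃ w : Pt d → ℝ, ∀ T ∈ t, IsLowerCell S w T := by
  obtain ⟨ht, f, g, hf, hfg, hne⟩ := h
  -- The points of `S` that are not vertices of `t` are lifted above the graph of `f`.
  refine ⟨fun p => if ∃ T ∈ t, p ∈ T then f p else f p + 1, fun T hT => ?_⟩
  have hTs : IsSimplex T := ⟨ht.card_eq T hT, ht.affineIndependent T hT⟩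
  have hint : interp T (fun p => if ∃ T ∈ t, p ∈ T then f p else f p + 1) = g T := by
    refine hTs.interp_eq fun p hp => ?_
    rw [if_pos ⟨T, hT, hp⟩, hfg T hT p (subset_convexHull ℝ _ hp)]
  refine ⟨hTs, ht.subset T hT, fun q hq hqT => ?_⟩
  rw [hint]
  have hqS : q ∈ convexHull ℝ (S : Set (Pt d)) := subset_convexHull ℝ _ hq
  split_ifs with hv
  · obtain ⟨T', hT', hqT'⟩ := hv
    refine affine_lt_of_regular ht hf hfg hne hT hqS fun hq' => ?_
    have hmem : q ∈ convexHull ℝ ((T' : Set (Pt d)) ∩ T) := by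
      rw [← ht.inter_eq T' hT' T hT]; exact ⟨subset_convexHull ℝ _ hqT', hq'⟩
    have hTs' : IsSimplex T' := ⟨ht.card_eq T' hT', ht.affineIndependent T' hT'⟩
    have h0 := hTs'.bary_eq_zero Set.inter_subset_left hqT' (fun h => hqT h.2) hmem
    rw [hTs'.bary_self hqT'] at h0
    exact one_ne_zero h0
  · obtain ⟨c, hc⟩ := hTs.interior_nonempty
    have := affine_le_of_convexOn hf (g T)
      (convexHull_mono (Finset.coe_subset.2 (ht.subset T hT))) (hfg T hT) hc hqS
    linarith

/-! ### Circuits and their two triangulations -/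

/-- Every `d + 1` points of `S` are affinely independent. -/
def AffinelyGeneric (S : Finset (Pt d)) : Prop :=
  ∀ T ⊆ S, T.card = d + 1 → AffineIndependent ℝ (fun p : {p : Pt d // p ∈ T} => (p : Pt d))

lemma GeneralPosition.affinelyGeneric {S : Finset (Pt d)} (h : GeneralPosition S) :
    AffinelyGeneric S := fun T hT hc => h.affineIndependent T hT hc.le

lemma GeneralPosition.mono {S S' : Finset (Pt d)} (h : GeneralPosition S) (hS : S' ⊆ S) :
    GeneralPosition S' :=
  ⟨fun T hT => h.affineIndependent T (hT.trans hS), fun T hT => h.not_cospherical T (hT.trans hS)⟩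

lemma AffinelyGeneric.isSimplex {S T : Finset (Pt d)} (hS : AffinelyGeneric S) (hT : T ⊆ S)
    (hc : T.card = d + 1) : IsSimplex T := ⟨hc, hS T hT hc⟩

/-- `l` is an affine dependence of the `d + 2` points `Z` with all coefficients nonzero, and any
`d + 1` of the points are affinely independent. -/
structure IsCircuit (Z : Finset (Pt d)) (l : Pt d → ℝ) : Prop where
  card_eq : Z.card = d + 2
  generic : AffinelyGeneric Z
  ne_zero : ∀ z ∈ Z, l z ≠ 0
  sum_eq_zero : ∑ z ∈ Z, l z = 0
  sum_smul_eq_zero : ∑ z ∈ Z, l z • z = 0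

/-- The affine dependence of `d + 2` generic points, normalized to be `1` at the point `q`. -/
lemma IsSimplex.isCircuit_insert {T : Finset (Pt d)} (hT : IsSimplex T) {q : Pt d} (hq : q ∉ T)
    (hg : AffinelyGeneric (insert q T)) :
    IsCircuit (insert q T) fun z => if z = q then 1 else -bary T z q := by
  have hTq : ∀ z ∈ T, z ≠ q := fun z hz h => hq (h ▸ hz)
  refine ⟨by rw [Finset.card_insert_of_notMem hq, hT.card_eq], hg, ?_, ?_, ?_⟩
  · intro z hz
    rcases Finset.mem_insert.1 hz with rfl | hz
    · simp
    · simp only [hTq z hz, if_false, ne_eq, neg_eq_zero]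
      -- otherwise `q` would be in the affine span of the face of `T` opposite to `z`
      intro h0
      have hc : (insert q (T.erase z)).card = d + 1 := by
        rw [Finset.card_insert_of_notMem (fun h => hq (Finset.mem_of_mem_erase h)),
          Finset.card_erase_of_mem hz, hT.card_eq]
        rfl
      have hT' : IsSimplex (insert q (T.erase z)) :=
        hg.isSimplex (Finset.insert_subset_insert q (Finset.erase_subset z T)) hc
      have : bary T z = 0 := by
        refine hT'.affine_ext fun p hp => ?_
        rcases Finset.mem_insert.1 hp with rfl | hp
        · simpa using h0
        · simpa using hT.bary_of_ne hz (Finset.mem_of_mem_erase hp) (Finset.ne_of_mem_erase hp).symm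
      have h1 := hT.bary_self hz
      rw [this] at h1
      simp at h1
  · rw [Finset.sum_insert hq, if_pos rfl, Finset.sum_congr rfl fun z hz => if_neg (hTq z hz),
      Finset.sum_neg_distrib, hT.sum_bary]
    simp
  · rw [Finset.sum_insert hq, if_pos rfl,
      Finset.sum_congr rfl fun z hz => by rw [if_neg (hTq z hz), neg_smul],
      Finset.sum_neg_distrib, hT.sum_bary_smul]
    simp

lemma sum_mul_affine_eq_zero {Z : Finset (Pt d)} {l : Pt d → ℝ} (h0 : ∑ z ∈ Z, l z = 0)
    (h1 : ∑ z ∈ Z, l z • z = 0) (g : Pt d →ᵃ[ℝ] ℝ) : ∑ z ∈ Z, l z * g z = 0 := by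
  have hg : ∀ x, g x = g.linear x + g 0 := fun x => congrFun g.decomp x
  have : ∀ p ∈ Z, l p * g p = g.linear (l p • p) + l p * g 0 := fun p _ => by
    rw [hg p, map_smul, smul_eq_mul]; ring
  rw [Finset.sum_congr rfl this, Finset.sum_add_distrib, ← Finset.sum_mul, h0, ← map_sum, h1]
  simp

namespace IsCircuit

variable {Z : Finset (Pt d)} {l : Pt d → ℝ}

lemma neg (h : IsCircuit Z l) : IsCircuit Z (-l) :=
  ⟨h.card_eq, h.generic, fun z hz => by simpa using h.ne_zero z hz, by simp [h.sum_eq_zero],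
    by simp [h.sum_smul_eq_zero]⟩

lemma isSimplex_erase (h : IsCircuit Z l) {p : Pt d} (hp : p ∈ Z) : IsSimplex (Z.erase p) :=
  h.generic.isSimplex (Finset.erase_subset p Z) (by
    rw [Finset.card_erase_of_mem hp, h.card_eq]; rfl)

/-- The height of the lifted point `p` above the hyperplane through the other ones, in terms of
the circuit. -/
lemma mul_sub_interp (h : IsCircuit Z l) {p : Pt d} (hp : p ∈ Z) (w : Pt d → ℝ) :
    l p * (w p - interp (Z.erase p) w p) = ∑ z ∈ Z, l z * w z := by
  have h0 := sum_mul_affine_eq_zero h.sum_eq_zero h.sum_smul_eq_zero (interp (Z.erase p) w)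
  rw [← sub_zero (∑ z ∈ Z, l z * w z), ← h0, ← Finset.sum_sub_distrib,
    Finset.sum_eq_single p]
  · ring
  · intro q hq hqp
    rw [(h.isSimplex_erase hp).interp_of_mem w (Finset.mem_erase.2 ⟨hqp, hq⟩), sub_self]
  · exact fun h => absurd hp h

lemma exists_pos (h : IsCircuit Z l) : ∃ p ∈ Z, 0 < l p := by
  by_contra! hc
  have hne : Z.Nonempty := by rw [← Finset.card_pos, h.card_eq]; omega
  obtain ⟨p, hp⟩ := hne
  exact h.ne_zero p hp ((Finset.sum_eq_zero_iff_of_nonpos hc).1 h.sum_eq_zero p hp)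

end IsCircuit

/-- One of the two triangulations of a circuit: the simplices opposite to the points with
positive coefficient. The other one belongs to `-l`. -/
noncomputable def circuitCells (Z : Finset (Pt d)) (l : Pt d → ℝ) : Cells d :=
  (Z.filter fun p => 0 < l p).image Z.erase

lemma mem_circuitCells {Z : Finset (Pt d)} {l : Pt d → ℝ} {T : Finset (Pt d)} :
    T ∈ circuitCells Z l ↔ ∃ p ∈ Z, 0 < l p ∧ Z.erase p = T := by
  simp [circuitCells, and_assoc]

namespace IsCircuit

variable {Z : Finset (Pt d)} {l : Pt d → ℝ}

lemma circuitCells_ne (h : IsCircuit Z l) : circuitCells Z l ≠ circuitCells Z (-l) := by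
  obtain ⟨p, hp, hpl⟩ := h.exists_pos
  intro heq
  have : Z.erase p ∈ circuitCells Z (-l) := heq ▸ mem_circuitCells.2 ⟨p, hp, hpl, rfl⟩
  obtain ⟨q, hq, hql, hqp⟩ := mem_circuitCells.1 this
  have hpq : q = p := by
    by_contra hne
    exact Finset.notMem_erase q Z (hqp ▸ Finset.mem_erase.2 ⟨hne, hq⟩)
  rw [hpq, Pi.neg_apply] at hql
  linarith

/-- Subtracting a multiple of the circuit from a convex combination makes a coefficient vanish. -/
lemma cover (h : IsCircuit Z l) : convexHull ℝ (Z : Set (Pt d)) ⊆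
    ⋃ T ∈ circuitCells Z l, convexHull ℝ (T : Set (Pt d)) := by
  intro x hx
  obtain ⟨μ, hμ0, hμ1, hμx⟩ := Finset.mem_convexHull'.1 hx
  have hne : (Z.filter fun p => 0 < l p).Nonempty := by
    obtain ⟨p, hp, hpl⟩ := h.exists_pos
    exact ⟨p, Finset.mem_filter.2 ⟨hp, hpl⟩⟩
  obtain ⟨p, hp, hmin⟩ := Finset.exists_min_image _ (fun p => μ p / l p) hne
  obtain ⟨hpZ, hpl⟩ := Finset.mem_filter.1 hp
  simp only [Set.mem_iUnion]
  refine ⟨Z.erase p, mem_circuitCells.2 ⟨p, hpZ, hpl, rfl⟩, ?_⟩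
  have hp0 : μ p - μ p / l p * l p = 0 := by field_simp; ring
  rw [Finset.mem_convexHull']
  refine ⟨fun z => μ z - μ p / l p * l z, fun z hz => ?_, ?_, ?_⟩
  · have hzZ := Finset.mem_of_mem_erase hz
    rcases le_or_gt (l z) 0 with hl | hl
    · have : 0 ≤ μ p / l p := div_nonneg (hμ0 p hpZ) hpl.le
      have := mul_nonpos_of_nonneg_of_nonpos this hl
      have := hμ0 z hzZ
      linarith
    · have := hmin z (Finset.mem_filter.2 ⟨hzZ, hl⟩)
      rw [le_div_iff₀ hl] at this
      linarith
  · rw [Finset.sum_erase Z (f := fun z => μ z - μ p / l p * l z) hp0, Finset.sum_sub_distrib,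
      ← Finset.mul_sum, h.sum_eq_zero, hμ1]
    simp
  · rw [Finset.sum_erase Z (f := fun z => (μ z - μ p / l p * l z) • z)
      (by simp only [hp0, zero_smul])]
    simp only [sub_smul, mul_smul]
    rw [Finset.sum_sub_distrib, ← Finset.smul_sum, h.sum_smul_eq_zero, hμx]
    simp

/-- The cells of a circuit are lower cells for suitable weights. -/
lemma isLowerCell (h : IsCircuit Z l) {w : Pt d → ℝ} (hw : 0 < ∑ z ∈ Z, l z * w z)
    {T : Finset (Pt d)} (hT : T ∈ circuitCells Z l) : IsLowerCell Z w T := by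
  obtain ⟨p, hp, hpl, rfl⟩ := mem_circuitCells.1 hT
  refine ⟨h.isSimplex_erase hp, Finset.erase_subset p Z, fun q hq hqp => ?_⟩
  obtain rfl : q = p := by
    by_contra hne
    exact hqp (Finset.mem_erase.2 ⟨hne, hq⟩)
  rw [← h.mul_sub_interp hq w] at hw
  have := (mul_pos_iff_of_pos_left hpl).1 hw
  linarith

lemma isRegularTriangulation (h : IsCircuit Z l) : IsRegularTriangulation Z (circuitCells Z l) := by
  refine isRegularTriangulation_of_isLowerCell (w := l) (fun T hT => h.isLowerCell ?_ hT) h.cover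
  obtain ⟨p, hp, hpl⟩ := h.exists_pos
  exact Finset.sum_pos' (fun z _ => mul_self_nonneg _) ⟨p, hp, mul_pos hpl hpl⟩

end IsCircuit

/-! ### Volumes of the simplices of a circuit -/

/-- The volume of the convex hull of a finite set of points. -/
noncomputable def hullVolume (T : Finset (Pt d)) : ℝ :=
  (MeasureTheory.volume (convexHull ℝ (T : Set (Pt d)))).toReal

lemma IsSimplex.hullVolume_pos {T : Finset (Pt d)} (hT : IsSimplex T) : 0 < hullVolume T := by
  refine ENNReal.toReal_pos ?_ ?_
  · exact (MeasureTheory.Measure.measure_pos_of_nonempty_interior _ hT.interior_nonempty).ne'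
  · exact (T.finite_toSet.isCompact_convexHull ℝ).measure_lt_top.ne

/-- The affine map that fixes the common face of two facets and maps the opposite vertices to each
other is a translate of a transvection, whose determinant is a quotient of coefficients. -/
lemma IsCircuit.abs_mul_hullVolume {Z : Finset (Pt d)} {l : Pt d → ℝ} (h : IsCircuit Z l)
    {p q : Pt d} (hp : p ∈ Z) (hq : q ∈ Z) :
    |l q| * hullVolume (Z.erase p) = |l p| * hullVolume (Z.erase q) := by
  rcases eq_or_ne p q with rfl | hpq
  · rfl
  have hT := h.isSimplex_erase hq
  have hpT : p ∈ Z.erase q := Finset.mem_erase.2 ⟨hpq, hp⟩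
  set b := bary (Z.erase q) p with hb
  have hbq : l q * b q = - l p := by
    have h0 := sum_mul_affine_eq_zero h.sum_eq_zero h.sum_smul_eq_zero b
    rw [← Finset.add_sum_erase _ _ hq, Finset.sum_eq_single p, hb, hT.bary_self hpT] at h0
    · linarith
    · intro z hz hzp
      rw [hT.bary_of_ne hpT hz hzp.symm, mul_zero]
    · exact fun h => absurd hpT h
  let φ : Pt d →ᵃ[ℝ] Pt d := AffineMap.id ℝ (Pt d) +
    (LinearMap.toSpanSingleton ℝ (Pt d) (q - p)).toAffineMap.comp b
  have hφ : ∀ x, φ x = x + b x • (q - p) := fun x => by simp [φ]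
  have himage : φ '' (Z.erase q : Finset (Pt d)) = (Z.erase p : Finset (Pt d)) := by
    have hfix : ∀ z ∈ Z.erase q, z ≠ p → φ z = z := fun z hz hzp => by
      rw [hφ, hb, hT.bary_of_ne hpT hz hzp.symm, zero_smul, add_zero]
    have hφp : φ p = q := by rw [hφ, hb, hT.bary_self hpT]; module
    ext z
    constructor
    · rintro ⟨y, hy, rfl⟩
      rcases eq_or_ne y p with rfl | hyp
      · rw [hφp]; exact Finset.mem_erase.2 ⟨hpq.symm, hq⟩
      · rw [hfix y hy hyp]; exact Finset.mem_erase.2 ⟨hyp, Finset.mem_of_mem_erase hy⟩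
    · intro hz
      have hz' := Finset.mem_erase.1 hz
      rcases eq_or_ne z q with rfl | hzq
      · exact ⟨p, hpT, hφp⟩
      · have : z ∈ Z.erase q := Finset.mem_erase.2 ⟨hzq, hz'.2⟩
        exact ⟨z, this, hfix z this hz'.1⟩
  have hlin : ∀ x, φ x = LinearMap.transvection b.linear (q - p) x + φ 0 := by
    intro x
    have := congrFun b.decomp x
    simp only [Pi.add_apply] at this
    rw [hφ, hφ, this, LinearMap.transvection.apply]
    module
  have hdet : (LinearMap.transvection b.linear (q - p)).det = b q := by
    rw [LinearMap.transvection.det]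
    have := b.linearMap_vsub q p
    simp only [vsub_eq_sub] at this
    rw [this, hb, hT.bary_self hpT]; ring
  have hvol : hullVolume (Z.erase p) = |b q| * hullVolume (Z.erase q) := by
    rw [hullVolume, ← himage, ← AffineMap.image_convexHull]
    have : φ '' convexHull ℝ (Z.erase q : Finset (Pt d)) = (fun x => x + φ 0) ''
        (LinearMap.transvection b.linear (q - p) '' convexHull ℝ (Z.erase q : Finset (Pt d))) := by
      rw [Set.image_image]
      exact Set.image_congr fun x _ => hlin x
    rw [this, Set.image_add_right, MeasureTheory.measure_preimage_add_right,
      MeasureTheory.Measure.addHaar_image_linearMap, hdet, ENNReal.toReal_mul,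
      ENNReal.toReal_ofReal (abs_nonneg _)]
    rfl
  rw [hvol, ← mul_assoc, ← abs_mul, hbq, abs_neg]

/-- The volumes of the simplices of a circuit are proportional to the coefficients. -/
lemma IsCircuit.exists_hullVolume {Z : Finset (Pt d)} {l : Pt d → ℝ} (h : IsCircuit Z l) :
    ∃ κ : ℝ, 0 < κ ∧ ∀ p ∈ Z, hullVolume (Z.erase p) = κ * |l p| := by
  obtain ⟨q, hq, hql⟩ := h.exists_pos
  have hpos : 0 < |l q| := abs_pos.2 hql.ne'
  refine ⟨hullVolume (Z.erase q) / |l q|, div_pos (h.isSimplex_erase hq).hullVolume_pos hpos,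
    fun p hp => ?_⟩
  have := h.abs_mul_hullVolume hp hq
  field_simp
  linarith

lemma sum_circuitCells {Z : Finset (Pt d)} (l : Pt d → ℝ) (F : Finset (Pt d) → ℝ) :
    ∑ T ∈ circuitCells Z l, F T = ∑ p ∈ Z with 0 < l p, F (Z.erase p) := by
  rw [circuitCells, Finset.sum_image]
  intro p hp q hq hpq
  have hp' := (Finset.mem_filter.1 hp).1
  by_contra hne
  exact Finset.notMem_erase p Z ((show Z.erase p = Z.erase q from hpq) ▸
    Finset.mem_erase.2 ⟨hne, hp'⟩)

/-- With volumes proportional to `|l|`, the values of `Vr` on the two triangulations of a circuit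
differ by a positive multiple of `∑ l z * ‖z‖ ^ 2`. -/
lemma IsCircuit.vr_lt {Z : Finset (Pt d)} {l : Pt d → ℝ} (h : IsCircuit Z l)
    (hneg : ∑ z ∈ Z, l z * ‖z‖ ^ 2 < 0) : Vr (circuitCells Z (-l)) < Vr (circuitCells Z l) := by
  obtain ⟨κ, hκ, hvol⟩ := h.exists_hullVolume
  have hterm : ∀ p ∈ Z, (∑ z ∈ Z.erase p, ‖z‖ ^ 2) * hullVolume (Z.erase p) =
      κ * (((∑ z ∈ Z, ‖z‖ ^ 2) - ‖p‖ ^ 2) * |l p|) := fun p hp => by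
    rw [hvol p hp, ← Finset.add_sum_erase Z (fun z => ‖z‖ ^ 2) hp]; ring
  set W := ∑ z ∈ Z, ‖z‖ ^ 2
  have h1 : Vr (circuitCells Z l) =
      ∑ p ∈ Z, if 0 < l p then κ * ((W - ‖p‖ ^ 2) * |l p|) else 0 := by
    rw [Vr, sum_circuitCells, ← Finset.sum_filter]
    exact Finset.sum_congr rfl fun p hp => hterm p (Finset.mem_filter.1 hp).1
  have h2 : Vr (circuitCells Z (-l)) =
      ∑ p ∈ Z, if 0 < (-l) p then κ * ((W - ‖p‖ ^ 2) * |l p|) else 0 := by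
    rw [Vr, sum_circuitCells, ← Finset.sum_filter]
    exact Finset.sum_congr rfl fun p hp => hterm p (Finset.mem_filter.1 hp).1
  have h3 : Vr (circuitCells Z l) - Vr (circuitCells Z (-l)) =
      ∑ p ∈ Z, κ * (W * l p - l p * ‖p‖ ^ 2) := by
    rw [h1, h2, ← Finset.sum_sub_distrib]
    refine Finset.sum_congr rfl fun p hp => ?_
    rcases lt_or_gt_of_ne (h.ne_zero p hp) with hl | hl
    · rw [if_neg hl.not_gt, if_pos (by simpa using hl), abs_of_neg hl]; ring
    · rw [if_pos hl, if_neg (by simpa using hl.le), abs_of_pos hl]; ring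
  rw [← Finset.mul_sum, Finset.sum_sub_distrib, ← Finset.mul_sum, h.sum_eq_zero] at h3
  nlinarith

lemma vr_nonneg (t : Cells d) : 0 ≤ Vr t :=
  Finset.sum_nonneg fun _ _ => mul_nonneg (Finset.sum_nonneg fun _ _ => sq_nonneg _)
    ENNReal.toReal_nonneg

/-- The new cells need not be disjoint from the remaining ones, since all summands of `Vr` are
nonnegative. -/
lemma vr_sdiff_union_lt {t t₁ t₂ : Cells d} (hsub : t₁ ⊆ t) (hlt : Vr t₂ < Vr t₁) :
    Vr ((t \ t₁) ∪ t₂) < Vr t := by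
  have h1 : Vr (t \ t₁) + Vr t₁ = Vr t := Finset.sum_sdiff hsub
  have h2 : Vr ((t \ t₁) ∪ t₂) + Vr ((t \ t₁) ∩ t₂) = Vr (t \ t₁) + Vr t₂ := Finset.sum_union_inter
  have h3 := vr_nonneg ((t \ t₁) ∩ t₂)
  linarith

/-! ### Varying the weights -/

/-- The height of the lifted point `q` above the hyperplane through the lifted vertices of `T`, as
a linear function of the weights. -/
noncomputable def excess (T : Finset (Pt d)) (q : Pt d) : (Pt d → ℝ) →ₗ[ℝ] ℝ where
  toFun w := w q - interp T w q
  map_add' w v := by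
    have := interp_add_smul T w v 1 q
    rw [one_smul, one_mul] at this
    rw [this, Pi.add_apply]; ring
  map_smul' a w := by
    have := interp_add_smul T 0 w a q
    have h0 : interp T (0 : Pt d → ℝ) q = 0 := by simp [interp_apply]
    rw [zero_add, h0, zero_add] at this
    rw [this, Pi.smul_apply, smul_eq_mul, smul_eq_mul, RingHom.id_apply]; ring

lemma excess_apply (T : Finset (Pt d)) (q : Pt d) (w : Pt d → ℝ) :
    excess T q w = w q - interp T w q := rfl

lemma isLowerCell_iff_excess {S T : Finset (Pt d)} {w : Pt d → ℝ} (hT : IsSimplex T)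
    (hTS : T ⊆ S) : IsLowerCell S w T ↔ ∀ q ∈ S, q ∉ T → 0 < excess T q w :=
  ⟨fun h q hq hqT => sub_pos.2 (h.lt q hq hqT), fun h => ⟨hT, hTS, fun q hq hqT =>
    sub_pos.1 (h q hq hqT)⟩⟩

lemma eventually_pos_linear {a : ℝ} (ha : 0 < a) (b : ℝ) : ∀ᶠ ε in 𝓝[>] (0 : ℝ), 0 < a + ε * b := by
  have hc : Continuous fun ε : ℝ => a + ε * b := by fun_prop
  have h0 : (fun ε : ℝ => a + ε * b) 0 ∈ Set.Ioi (0 : ℝ) := by simpa using ha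
  exact (hc.continuousAt.eventually_mem (isOpen_Ioi.mem_nhds h0)).filter_mono nhdsWithin_le_nhds

lemma eventually_ne_linear {a b : ℝ} (hb : b ≠ 0) : ∀ᶠ ε in 𝓝[>] (0 : ℝ), a + ε * b ≠ 0 := by
  rcases lt_trichotomy a 0 with ha | rfl | ha
  · filter_upwards [eventually_pos_linear (neg_pos.2 ha) (-b)] with ε hε
    intro h; linarith
  · filter_upwards [self_mem_nhdsWithin] with ε hε
    have : ε ≠ 0 := (Set.mem_Ioi.1 hε).ne'
    simp [this, hb]
  · filter_upwards [eventually_pos_linear ha b] with ε hε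
    exact hε.ne'

lemma IsLowerCell.eventually {S T : Finset (Pt d)} {w : Pt d → ℝ} (h : IsLowerCell S w T)
    (v : Pt d → ℝ) : ∀ᶠ ε in 𝓝[>] (0 : ℝ), IsLowerCell S (w + ε • v) T := by
  have : ∀ᶠ ε in 𝓝[>] (0 : ℝ), ∀ q ∈ S, q ∉ T → 0 < excess T q (w + ε • v) := by
    rw [Filter.eventually_all_finset]
    intro q hq
    by_cases hqT : q ∈ T
    · exact Eventually.of_forall fun ε h => absurd hqT h
    · filter_upwards [eventually_pos_linear (sub_pos.2 (h.lt q hq hqT)) (excess T q v)] with ε hε _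
      rw [map_add, map_smul, smul_eq_mul]
      exact hε
  filter_upwards [this] with ε hε
  exact (isLowerCell_iff_excess h.toIsSimplex h.subset).2 hε

/-- If the lifted points of a circuit `Z` span a face of the lower hull, then moving the weights in
a direction in which the circuit is positive breaks up this face into `circuitCells Z l`. -/
lemma IsCircuit.eventually_isLowerCell {S Z : Finset (Pt d)} {l w v : Pt d → ℝ} {h : Pt d →ᵃ[ℝ] ℝ}
    (hZ : IsCircuit Z l) (hZS : Z ⊆ S) (hh : ∀ z ∈ Z, h z = w z) (hlt : ∀ q ∈ S, q ∉ Z → h q < w q)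
    (hv : 0 < ∑ z ∈ Z, l z * v z) :
    ∀ᶠ ε in 𝓝[>] (0 : ℝ), ∀ T ∈ circuitCells Z l, IsLowerCell S (w + ε • v) T := by
  rw [Filter.eventually_all_finset]
  intro T hT
  obtain ⟨p, hp, hpl, rfl⟩ := mem_circuitCells.1 hT
  have hs := hZ.isSimplex_erase hp
  have hint : interp (Z.erase p) w = h := hs.interp_eq fun z hz => hh z (Finset.mem_of_mem_erase hz)
  have : ∀ᶠ ε in 𝓝[>] (0 : ℝ), ∀ q ∈ S, q ∉ Z.erase p → 0 < excess (Z.erase p) q (w + ε • v) := by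
    rw [Filter.eventually_all_finset]
    intro q hq
    by_cases hqZ : q ∈ Z
    · filter_upwards [self_mem_nhdsWithin] with ε hε hqT
      obtain rfl : q = p := by
        by_contra hne
        exact hqT (Finset.mem_erase.2 ⟨hne, hqZ⟩)
      have h0 : excess (Z.erase q) q w = 0 := by rw [excess_apply, hint, hh q hqZ, sub_self]
      have h1 : l q * excess (Z.erase q) q v = ∑ z ∈ Z, l z * v z := hZ.mul_sub_interp hqZ v
      rw [map_add, map_smul, smul_eq_mul, h0, zero_add]
      refine mul_pos hε ?_
      rw [← h1] at hv
      exact (mul_pos_iff_of_pos_left hpl).1 hv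
    · have hpos : 0 < excess (Z.erase p) q w := by
        rw [excess_apply, hint]; exact sub_pos.2 (hlt q hq hqZ)
      filter_upwards [eventually_pos_linear hpos (excess (Z.erase p) q v)] with ε hε _
      rw [map_add, map_smul, smul_eq_mul]
      exact hε
  filter_upwards [this] with ε hε
  exact (isLowerCell_iff_excess hs ((Finset.erase_subset p Z).trans hZS)).2 hε

/-- A flip of a regular triangulation on a circuit `Z` is regular if for suitable weights the
lifted points of `Z` span a face of the lower hull, and the cells outside `Z` are lower cells. -/
lemma IsCircuit.isRegularTriangulation_flip {S Z : Finset (Pt d)} {l w v : Pt d → ℝ}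
    {h : Pt d →ᵃ[ℝ] ℝ} {t : Cells d} (hZ : IsCircuit Z l) (hZS : Z ⊆ S)
    (hh : ∀ z ∈ Z, h z = w z) (hlt : ∀ q ∈ S, q ∉ Z → h q < w q)
    (hv : ∑ z ∈ Z, l z * v z < 0)
    (hcover : convexHull ℝ (S : Set (Pt d)) ⊆ ⋃ T ∈ t, convexHull ℝ (T : Set (Pt d)))
    (hrest : ∀ T ∈ t, T ∉ circuitCells Z l → IsLowerCell S w T) :
    IsRegularTriangulation S ((t \ circuitCells Z l) ∪ circuitCells Z (-l)) := by
  have h1 : ∀ᶠ ε in 𝓝[>] (0 : ℝ), ∀ T ∈ t \ circuitCells Z l, IsLowerCell S (w + ε • v) T := by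
    rw [Filter.eventually_all_finset]
    intro T hT
    exact (hrest T (Finset.mem_sdiff.1 hT).1 (Finset.mem_sdiff.1 hT).2).eventually v
  have h2 := hZ.neg.eventually_isLowerCell hZS hh hlt (v := v) (by simpa using hv)
  obtain ⟨ε, hε1, hε2⟩ := (h1.and h2).exists
  refine isRegularTriangulation_of_isLowerCell (w := w + ε • v) (fun T hT => ?_) fun x hx => ?_
  · rcases Finset.mem_union.1 hT with hT | hT
    · exact hε1 T hT
    · exact hε2 T hT
  · have hxt := hcover hx
    simp only [Set.mem_iUnion] at hxt ⊢
    obtain ⟨T, hT, hxT⟩ := hxt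
    by_cases hTc : T ∈ circuitCells Z l
    · obtain ⟨p, hp, hpl, rfl⟩ := mem_circuitCells.1 hTc
      have := hZ.neg.cover (convexHull_mono (Finset.coe_subset.2 (Finset.erase_subset p Z)) hxT)
      simp only [Set.mem_iUnion] at this
      obtain ⟨T', hT', hxT'⟩ := this
      exact ⟨T', Finset.mem_union_right _ hT', hxT'⟩
    · exact ⟨T, Finset.mem_union_left _ (Finset.mem_sdiff.2 ⟨hT, hTc⟩), hxT⟩

lemma IsCircuit.isFlip {Z : Finset (Pt d)} {l : Pt d → ℝ} {t : Cells d} (hZ : IsCircuit Z l)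
    (hsub : circuitCells Z l ⊆ t) :
    IsFlip Z t ((t \ circuitCells Z l) ∪ circuitCells Z (-l)) :=
  ⟨hZ.card_eq, _, _, hsub, hZ.isRegularTriangulation.1, hZ.neg.isRegularTriangulation.1,
    hZ.circuitCells_ne, rfl⟩

/-- From every point there is a direction in which finitely many nonzero linear functionals all
become nonzero at once. -/
lemma exists_eventually_forall_ne_zero {V : Type*} [AddCommGroup V] [Module ℝ V]
    (L : Finset (V →ₗ[ℝ] ℝ)) (hL : ∀ f ∈ L, f ≠ 0) (w : V) :
    ∃ v : V, ∀ᶠ ε in 𝓝[>] (0 : ℝ), ∀ f ∈ L, f (w + ε • v) ≠ 0 := by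
  have htop : (⊤ : Subspace ℝ V) ∉ L.image fun f => LinearMap.ker f := by
    intro h
    obtain ⟨f, hf, hker⟩ := Finset.mem_image.1 h
    exact hL f hf (LinearMap.ker_eq_top.1 hker)
  obtain ⟨v, hv⟩ := (Set.ne_univ_iff_exists_notMem _).1
    (Subspace.biUnion_ne_univ_of_top_notMem htop)
  refine ⟨v, (Filter.eventually_all_finset L).2 fun f hf => ?_⟩
  have hfv : f v ≠ 0 := fun h => hv (Set.mem_biUnion
    (Finset.mem_coe.2 (Finset.mem_image.2 ⟨f, hf, rfl⟩)) (by simpa using h))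
  filter_upwards [eventually_ne_linear (a := f w) hfv] with ε hε
  rwa [map_add, map_smul, smul_eq_mul]

/-! ### The parabolic weights and Delaunay triangulations -/

/-- The weights of the Delaunay triangulation. -/
noncomputable def parabola (d : ℕ) : Pt d → ℝ := fun p => ‖p‖ ^ 2

/-- The height of the paraboloid above a hyperplane is the power with respect to a sphere. -/
lemma exists_center (g : Pt d →ᵃ[ℝ] ℝ) :
    ∃ (c : Pt d) (b : ℝ), ∀ y, ‖y‖ ^ 2 - g y = dist c y ^ 2 - b := by
  let f : Pt d →L[ℝ] ℝ := LinearMap.toContinuousLinearMap g.linear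
  refine ⟨(2 : ℝ)⁻¹ • (InnerProductSpace.toDual ℝ (Pt d)).symm f,
    ‖(2 : ℝ)⁻¹ • (InnerProductSpace.toDual ℝ (Pt d)).symm f‖ ^ 2 + g 0, fun y => ?_⟩
  have h1 : g y = g.linear y + g 0 := congrFun g.decomp y
  have h2 : inner ℝ ((InnerProductSpace.toDual ℝ (Pt d)).symm f) y = g.linear y := by
    rw [InnerProductSpace.toDual_symm_apply]; rfl
  rw [dist_eq_norm, norm_sub_sq_real, inner_smul_left, h2, h1]
  simp only [conj_trivial]
  ring

/-- Conversely, every sphere comes from an affine function. -/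
lemma exists_affine_of_sphere (c : Pt d) (b : ℝ) :
    ∃ g : Pt d →ᵃ[ℝ] ℝ, ∀ y, ‖y‖ ^ 2 - g y = dist c y ^ 2 - b := by
  refine ⟨((2 : ℝ) • (innerSL ℝ c).toLinearMap).toAffineMap +
    AffineMap.const ℝ (Pt d) (b - ‖c‖ ^ 2), fun y => ?_⟩
  rw [dist_eq_norm, norm_sub_sq_real]
  simp
  ring

lemma excess_parabola_ne_zero {S T : Finset (Pt d)} (hS : GeneralPosition S) (hT : IsSimplex T)
    (hTS : T ⊆ S) {q : Pt d} (hq : q ∈ S) (hqT : q ∉ T) : excess T q (parabola d) ≠ 0 := by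
  intro h0
  obtain ⟨c, b, hcb⟩ := exists_center (interp T (parabola d))
  have hon : ∀ y ∈ insert q T, dist y c ^ 2 = b := by
    intro y hy
    have h1 := hcb y
    rw [dist_comm y c]
    rcases Finset.mem_insert.1 hy with rfl | hy
    · rw [excess_apply, parabola] at h0
      change ‖y‖ ^ 2 - _ = 0 at h0
      have h2 := h0.symm.trans h1
      linarith
    · rw [hT.interp_of_mem _ hy, parabola] at h1
      linarith
  refine hS.not_cospherical (insert q T) (Finset.insert_subset hq hTS)
    (by rw [Finset.card_insert_of_notMem hqT, hT.card_eq]) ⟨c, √b, fun y hy => ?_⟩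
  rw [← hon y hy, Real.sqrt_sq dist_nonneg]

lemma mem_delaunay_iff {S T : Finset (Pt d)} (hS : GeneralPosition S) :
    T ∈ delaunay S ↔ IsLowerCell S (parabola d) T := by
  rw [delaunay, Finset.mem_filter, Finset.mem_powersetCard]
  constructor
  · rintro ⟨⟨hTS, hc⟩, c, hcell⟩
    have hT : IsSimplex T := hS.affinelyGeneric.isSimplex hTS hc
    refine (isLowerCell_iff_excess hT hTS).2 fun q hq hqT =>
      lt_of_le_of_ne ?_ (excess_parabola_ne_zero hS hT hTS hq hqT).symm
    obtain ⟨p, hp⟩ := hT.nonempty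
    obtain ⟨g, hg⟩ := exists_affine_of_sphere c (dist c p ^ 2)
    have hint : interp T (parabola d) = g := by
      refine hT.interp_eq fun y hy => ?_
      have h1 : dist c p = dist c y := le_antisymm (hcell p hp y (hTS hy)) (hcell y hy p (hTS hp))
      have h2 := hg y
      rw [h1, sub_self] at h2
      exact (sub_eq_zero.1 h2).symm
    have h2 : dist c p ^ 2 ≤ dist c q ^ 2 := pow_le_pow_left₀ dist_nonneg (hcell p hp q hq) 2
    have h3 := hg q
    rw [excess_apply, hint, parabola]
    linarith
  · intro hT
    refine ⟨⟨hT.subset, hT.card_eq⟩, ?_⟩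
    obtain ⟨c, b, hcb⟩ := exists_center (interp T (parabola d))
    refine ⟨c, fun p hp q hq => ?_⟩
    have h1 := hcb p
    have h2 := hcb q
    rw [hT.interp_of_mem _ hp, parabola, sub_self] at h1
    have h3 : interp T (parabola d) q ≤ ‖q‖ ^ 2 := hT.interp_le hq
    exact (pow_le_pow_iff_left₀ dist_nonneg dist_nonneg two_ne_zero).1 (by linarith)

/-! ### Improving flips -/

/-- A regular triangulation has generic weights: on the segment from them to the parabolic weights
no two circuits degenerate simultaneously. -/
lemma IsRegularTriangulation.exists_generic_weights {S : Finset (Pt d)} (hS : GeneralPosition S)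
    {t : Cells d} (ht : IsRegularTriangulation S t) :
    ∃ w : Pt d → ℝ, (∀ T ∈ t, IsLowerCell S w T) ∧
      ∀ T ∈ t, ∀ q ∈ S, q ∉ T → ∀ T' ∈ t, ∀ q' ∈ S, q' ∉ T' → insert q T ≠ insert q' T' →
        excess T q w * excess T' q' (parabola d) ≠ excess T' q' w * excess T q (parabola d) := by
  obtain ⟨w₀, hw₀⟩ := ht.exists_weights
  let P := (t ×ˢ S).filter fun a => a.2 ∉ a.1
  let L : Finset ((Pt d → ℝ) →ₗ[ℝ] ℝ) :=
    ((P ×ˢ P).filter fun a => ¬ insert a.1.2 a.1.1 ⊆ insert a.2.2 a.2.1).image fun a =>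
      excess a.2.1 a.2.2 (parabola d) • excess a.1.1 a.1.2 -
        excess a.1.1 a.1.2 (parabola d) • excess a.2.1 a.2.2
  have hL : ∀ f ∈ L, f ≠ 0 := by
    intro f hf
    obtain ⟨⟨⟨T, q⟩, ⟨T', q'⟩⟩, ha, rfl⟩ := Finset.mem_image.1 hf
    simp only [P, Finset.mem_filter, Finset.mem_product] at ha
    obtain ⟨⟨⟨⟨hT, hq⟩, hqT⟩, ⟨hT', hq'⟩, hqT'⟩, hne⟩ := ha
    obtain ⟨u, hu, hu'⟩ := Finset.not_subset.1 hne
    have hTs := hw₀ T hT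
    have hTs' := hw₀ T' hT'
    -- The first functional, but not the second one, depends on the weight of the point `u`.
    intro h0
    have h1 := LinearMap.congr_fun h0 (Pi.single u 1)
    have h2 : excess T' q' (Pi.single u 1) = 0 := by
      rw [excess_apply, interp_apply, Finset.sum_eq_zero, Pi.single_eq_of_ne]
      · simp
      · rintro rfl; exact hu' (Finset.mem_insert_self _ _)
      · intro p hp
        rw [Pi.single_eq_of_ne, zero_mul]
        rintro rfl; exact hu' (Finset.mem_insert_of_mem hp)
    have hcirc := hTs.toIsSimplex.isCircuit_insert hqT fun U hU => hS.affinelyGeneric U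
      (hU.trans (Finset.insert_subset hq hTs.subset))
    have h3 : excess T q (Pi.single u 1) ≠ 0 := by
      have h4 := hcirc.mul_sub_interp (Finset.mem_insert_self q T) (Pi.single u (1 : ℝ))
      rw [Finset.erase_insert hqT, if_pos rfl, one_mul,
        Finset.sum_eq_single u (fun z _ hz => by rw [Pi.single_eq_of_ne hz, mul_zero])
          (fun h => absurd hu h), Pi.single_eq_same, mul_one] at h4
      rw [excess_apply, h4]
      exact hcirc.ne_zero u hu
    simp only [LinearMap.sub_apply, LinearMap.smul_apply, smul_eq_mul, h2, mul_zero, sub_zero,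
      LinearMap.zero_apply] at h1
    exact mul_ne_zero (excess_parabola_ne_zero hS hTs'.toIsSimplex hTs'.subset hq' hqT') h3 h1
  obtain ⟨v, hv⟩ := exists_eventually_forall_ne_zero L hL w₀
  have hev : ∀ᶠ ε in 𝓝[>] (0 : ℝ), ∀ T ∈ t, IsLowerCell S (w₀ + ε • v) T :=
    (Filter.eventually_all_finset t).2 fun T hT => (hw₀ T hT).eventually v
  obtain ⟨ε, hε1, hε2⟩ := (hv.and hev).exists
  refine ⟨w₀ + ε • v, hε2, fun T hT q hq hqT T' hT' q' hq' hqT' hne heq => ?_⟩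
  have hcard : (insert q T).card = (insert q' T').card := by
    rw [Finset.card_insert_of_notMem hqT, Finset.card_insert_of_notMem hqT', (hε2 T hT).card_eq,
      (hε2 T' hT').card_eq]
  refine hε1 _ (Finset.mem_image.2 ⟨⟨⟨T, q⟩, ⟨T', q'⟩⟩, ?_, rfl⟩) ?_
  · simp only [P, Finset.mem_filter, Finset.mem_product]
    exact ⟨⟨⟨⟨hT, hq⟩, hqT⟩, ⟨hT', hq'⟩, hqT'⟩, fun h =>
      hne (Finset.eq_of_subset_of_card_le h hcard.ge)⟩
  · rw [LinearMap.sub_apply, LinearMap.smul_apply, LinearMap.smul_apply, smul_eq_mul, smul_eq_mul]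
    linarith

/-- A regular triangulation that is not Delaunay has an improving flip: move generic weights
linearly to the parabolic ones, and perform the flip that happens when the triangulation changes
for the first time. The flip is towards the lower hull of the paraboloid. -/
theorem exists_isImprovingFlip {S : Finset (Pt d)} (hS : GeneralPosition S) {t : Cells d}
    (ht : IsRegularTriangulation S t) {T₁ : Finset (Pt d)} (hT₁ : T₁ ∈ t)
    (hnot : ¬ IsLowerCell S (parabola d) T₁) : ∃ t', IsImprovingFlip S t t' := by
  obtain ⟨w, hw, hgen⟩ := ht.exists_generic_weights hS
  have hpos : ∀ T ∈ t, ∀ q ∈ S, q ∉ T → 0 < excess T q w := fun T hT =>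
    (isLowerCell_iff_excess (hw T hT).toIsSimplex (hw T hT).subset).1 (hw T hT)
  let E := (t ×ˢ S).filter fun a => a.2 ∉ a.1 ∧ excess a.1 a.2 (parabola d) < 0
  have hE : E.Nonempty := by
    rw [isLowerCell_iff_excess (hw T₁ hT₁).toIsSimplex (hw T₁ hT₁).subset] at hnot
    push Not at hnot
    obtain ⟨q, hq, hqT, hle⟩ := hnot
    exact ⟨(T₁, q), Finset.mem_filter.2 ⟨Finset.mem_product.2 ⟨hT₁, hq⟩, hqT, lt_of_le_of_ne hle
      (excess_parabola_ne_zero hS (hw T₁ hT₁).toIsSimplex (hw T₁ hT₁).subset hq hqT)⟩⟩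
  -- The first time `s` at which a circuit degenerates, and this circuit `Z = T₀ ∪ {q₀}`.
  obtain ⟨⟨T₀, q₀⟩, hmem, hmin⟩ := Finset.exists_min_image E
    (fun a => excess a.1 a.2 w / (excess a.1 a.2 w - excess a.1 a.2 (parabola d))) hE
  simp only [E, Finset.mem_filter, Finset.mem_product] at hmem
  obtain ⟨⟨hT₀, hq₀⟩, hqT₀, hb₀⟩ := hmem
  have ha₀ := hpos T₀ hT₀ q₀ hq₀ hqT₀
  set s := excess T₀ q₀ w / (excess T₀ q₀ w - excess T₀ q₀ (parabola d)) with hs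
  have hs0 : 0 < s := div_pos ha₀ (by linarith)
  have hs1 : s < 1 := (div_lt_one (by linarith)).2 (by linarith)
  have hsmul : s * (excess T₀ q₀ w - excess T₀ q₀ (parabola d)) = excess T₀ q₀ w :=
    div_mul_cancel₀ _ (by linarith)
  set v := parabola d - w with hvdef
  set w' := w + s • v with hw'def
  have hw' : ∀ T q, excess T q w' = (1 - s) * excess T q w + s * excess T q (parabola d) := by
    intro T q
    rw [hw'def, hvdef, map_add, map_smul, map_sub, smul_eq_mul]; ring
  have h00 : excess T₀ q₀ w' = 0 := by rw [hw']; linarith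
  have hnonneg : ∀ T ∈ t, ∀ q ∈ S, q ∉ T → 0 ≤ excess T q w' := by
    intro T hT q hq hqT
    have ha := hpos T hT q hq hqT
    rw [hw']
    rcases lt_or_ge (excess T q (parabola d)) 0 with hb | hb
    · have h1 := hmin (T, q) (Finset.mem_filter.2 ⟨Finset.mem_product.2 ⟨hT, hq⟩, hqT, hb⟩)
      rw [le_div_iff₀ (by simp only; linarith)] at h1
      simp only at h1
      linarith
    · have := mul_pos (sub_pos.2 hs1) ha
      have := mul_nonneg hs0.le hb
      linarith
  have huniq : ∀ T ∈ t, ∀ q ∈ S, q ∉ T → excess T q w' = 0 → insert q T = insert q₀ T₀ := by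
    intro T hT q hq hqT h0
    by_contra hne
    refine hgen T hT q hq hqT T₀ hT₀ q₀ hq₀ hqT₀ hne ?_
    rw [hw'] at h0 h00
    have hs1' : 1 - s ≠ 0 := by linarith
    refine mul_left_cancel₀ hs1' ?_
    linear_combination excess T₀ q₀ (parabola d) * h0 - excess T q (parabola d) * h00
  have hT₀s := hw T₀ hT₀
  have hZS : insert q₀ T₀ ⊆ S := Finset.insert_subset hq₀ hT₀s.subset
  have hcirc := hT₀s.toIsSimplex.isCircuit_insert hqT₀ fun U hU =>
    hS.affinelyGeneric U (hU.trans hZS)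
  set Z := insert q₀ T₀
  set l : Pt d → ℝ := fun z => if z = q₀ then 1 else -bary T₀ z q₀
  have hlsum : ∀ u : Pt d → ℝ, ∑ z ∈ Z, l z * u z = excess T₀ q₀ u := by
    intro u
    have := hcirc.mul_sub_interp (Finset.mem_insert_self q₀ T₀) u
    rw [Finset.erase_insert hqT₀] at this
    rw [← this, excess_apply, show l q₀ = 1 from if_pos rfl, one_mul]
  have hcover : convexHull ℝ (S : Set (Pt d)) ⊆ ⋃ T ∈ t, convexHull ℝ (T : Set (Pt d)) :=
    ht.1.cover.ge
  have hh : ∀ z ∈ Z, interp T₀ w' z = w' z := by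
    intro z hz
    rcases Finset.mem_insert.1 hz with rfl | hz
    · rw [excess_apply] at h00; linarith
    · exact hT₀s.interp_of_mem w' hz
  have hlt : ∀ q ∈ S, q ∉ Z → interp T₀ w' q < w' q := by
    intro q hq hqZ
    have hqT : q ∉ T₀ := fun h => hqZ (Finset.mem_insert_of_mem h)
    refine sub_pos.1 (lt_of_le_of_ne (hnonneg T₀ hT₀ q hq hqT) fun h0 => hqZ ?_)
    exact huniq T₀ hT₀ q hq hqT h0.symm ▸ Finset.mem_insert_self q T₀
  have hvneg : ∑ z ∈ Z, l z * v z < 0 := by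
    rw [hlsum, hvdef, map_sub]; linarith
  have hrest : ∀ T ∈ t, T ∉ circuitCells Z l → IsLowerCell S w' T := by
    intro T hT hTc
    refine (isLowerCell_iff_excess (hw T hT).toIsSimplex (hw T hT).subset).2 fun q hq hqT =>
      lt_of_le_of_ne (hnonneg T hT q hq hqT) fun h0 => hTc ?_
    have hZ := huniq T hT q hq hqT h0.symm
    have hqZ : q ∈ Z := hZ ▸ Finset.mem_insert_self q T
    have hTZ : Z.erase q = T := by rw [← hZ, Finset.erase_insert hqT]
    refine mem_circuitCells.2 ⟨q, hqZ, ?_, hTZ⟩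
    have h1 := hcirc.mul_sub_interp hqZ w
    rw [hTZ, hlsum, ← excess_apply] at h1
    rw [← h1] at ha₀
    exact (pos_iff_pos_of_mul_pos ha₀).2 (hpos T hT q hq hqT)
  -- Shortly before the time `s`, the cells of the circuit are lower cells.
  have hsub : circuitCells Z l ⊆ t := by
    have h1 := hcirc.eventually_isLowerCell hZS hh hlt (v := -v) (by
      simp only [Pi.neg_apply, mul_neg, Finset.sum_neg_distrib]; linarith)
    have h2 : ∀ᶠ ε in 𝓝[>] (0 : ℝ), ε ∈ Set.Ioo 0 s := Ioo_mem_nhdsGT hs0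
    obtain ⟨ε, hε, hε0, hεs⟩ := (h1.and h2).exists
    intro T hT
    refine mem_of_isLowerCell (w := w' + ε • -v) (fun T hT => ?_) hcover (hε T hT)
    refine (isLowerCell_iff_excess (hw T hT).toIsSimplex (hw T hT).subset).2 fun q hq hqT => ?_
    have hx : s * excess T q (w' + ε • -v) = ε * excess T q w + (s - ε) * excess T q w' := by
      rw [hw'def, hvdef]
      simp only [map_add, map_smul, map_sub, map_neg, smul_eq_mul]; ring
    have h3 := mul_pos hε0 (hpos T hT q hq hqT)
    have h4 := mul_nonneg (sub_pos.2 hεs).le (hnonneg T hT q hq hqT)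
    exact (mul_pos_iff_of_pos_left hs0).1 (by linarith)
  refine ⟨(t \ circuitCells Z l) ∪ circuitCells Z (-l), ⟨Z, hZS, hcirc.isFlip hsub⟩,
    hcirc.isRegularTriangulation_flip hZS hh hlt hvneg hcover hrest,
    vr_sdiff_union_lt hsub (hcirc.vr_lt ?_)⟩
  have := hlsum (parabola d)
  simp only [parabola] at this
  rw [this]
  exact hb₀

/-- Locally optimal triangulations are Delaunay triangulations. -/
theorem IsLOT.eq_delaunay {S : Finset (Pt d)} (hS : GeneralPosition S) {t : Cells d}
    (ht : IsLOT S t) : t = delaunay S := by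
  have hlower : ∀ T ∈ t, IsLowerCell S (parabola d) T := by
    intro T hT
    by_contra hnot
    exact ht.2 (exists_isImprovingFlip hS ht.1 hT hnot)
  ext T
  rw [mem_delaunay_iff hS]
  exact ⟨hlower T, mem_of_isLowerCell hlower ht.1.1.cover.ge⟩

/-! ### Insertion of a point -/

/-- The circuit of a simplex `s` and a further point `x`, with coefficient `1` at `x`. -/
noncomputable def insertionCircuit (s : Finset (Pt d)) (x : Pt d) : Pt d → ℝ :=
  fun z => if z = x then 1 else -bary s z x

/-- The situation in which a point is inserted: `s` is a simplex of the regular triangulation `t`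
of `S` which contains the new point `x`. -/
structure IsInsertion (S : Finset (Pt d)) (t : Cells d) (s : Finset (Pt d)) (x : Pt d) : Prop where
  generalPosition : GeneralPosition (insert x S)
  notMem : x ∉ S
  regular : IsRegularTriangulation S t
  mem : s ∈ t
  mem_convexHull : x ∈ convexHull ℝ (s : Set (Pt d))

namespace IsInsertion

variable {S : Finset (Pt d)} {t : Cells d} {s : Finset (Pt d)} {x : Pt d} (h : IsInsertion S t s x)
include h

lemma subset : s ⊆ S := h.regular.1.subset s h.mem

lemma notMem_cell : x ∉ s := fun hx => h.notMem (h.subset hx)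

lemma isSimplex : IsSimplex s :=
  ⟨h.regular.1.card_eq s h.mem, h.regular.1.affineIndependent s h.mem⟩

lemma isCircuit : IsCircuit (insert x s) (insertionCircuit s x) :=
  h.isSimplex.isCircuit_insert h.notMem_cell fun U hU =>
    h.generalPosition.affinelyGeneric U (hU.trans (Finset.insert_subset_insert x h.subset))

lemma bary_pos {p : Pt d} (hp : p ∈ s) : 0 < bary s p x := by
  refine lt_of_le_of_ne (h.isSimplex.mem_convexHull_iff.1 h.mem_convexHull p hp) fun h0 => ?_
  have h1 := h.isCircuit.ne_zero p (Finset.mem_insert_of_mem hp)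
  have hpx : p ≠ x := fun hpx => h.notMem_cell (hpx ▸ hp)
  rw [insertionCircuit, if_neg hpx, ← h0, neg_zero] at h1
  exact h1 rfl

lemma eq_of_mem_convexHull_inter {T : Finset (Pt d)} (hT : T.card = d + 1)
    (hx : x ∈ convexHull ℝ ((s : Set (Pt d)) ∩ T)) : T = s := by
  refine (Finset.eq_of_subset_of_card_le (fun p hp => ?_) (by rw [hT, h.isSimplex.card_eq])).symm
  by_contra hpT
  exact (h.bary_pos hp).ne'
    (h.isSimplex.bary_eq_zero Set.inter_subset_left hp (fun h => hpT h.2) hx)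

lemma circuitCells_eq : circuitCells (insert x s) (insertionCircuit s x) = {s} := by
  ext T
  rw [mem_circuitCells, Finset.mem_singleton]
  constructor
  · rintro ⟨p, hp, hpl, rfl⟩
    rcases Finset.mem_insert.1 hp with rfl | hp
    · rw [Finset.erase_insert h.notMem_cell]
    · have hpx : p ≠ x := fun hpx => h.notMem_cell (hpx ▸ hp)
      rw [insertionCircuit, if_neg hpx] at hpl
      have := h.bary_pos hp
      linarith
  · rintro rfl
    refine ⟨x, Finset.mem_insert_self x T, ?_, Finset.erase_insert h.notMem_cell⟩
    rw [insertionCircuit, if_pos rfl]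
    exact one_pos

lemma sum_mul_eq_excess (u : Pt d → ℝ) :
    ∑ z ∈ insert x s, insertionCircuit s x z * u z = excess s x u := by
  rw [← h.isCircuit.mul_sub_interp (Finset.mem_insert_self x s), Finset.erase_insert h.notMem_cell,
    insertionCircuit, if_pos rfl, one_mul, excess_apply]

lemma excess_parabola_neg : excess s x (parabola d) < 0 := by
  refine lt_of_le_of_ne ?_ (excess_parabola_ne_zero h.generalPosition h.isSimplex
    (h.subset.trans (Finset.subset_insert x S)) (Finset.mem_insert_self x S) h.notMem_cell)
  obtain ⟨c, b, hcb⟩ := exists_center (interp s (parabola d))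
  -- The vertices of `s` lie on a sphere, and the ball bounded by it is convex.
  have hball : convexHull ℝ (s : Set (Pt d)) ⊆ Metric.closedBall c (√b) := by
    refine convexHull_min (fun y hy => ?_) (convex_closedBall _ _)
    have h1 := hcb y
    rw [h.isSimplex.interp_of_mem _ hy, parabola, sub_self] at h1
    rw [Metric.mem_closedBall, dist_comm]
    exact Real.le_sqrt_of_sq_le (by linarith)
  have hb : 0 ≤ b := by
    obtain ⟨y, hy⟩ := h.isSimplex.nonempty
    have h1 := hcb y
    rw [h.isSimplex.interp_of_mem _ hy, parabola, sub_self] at h1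
    nlinarith [sq_nonneg (dist c y)]
  have h2 := hball h.mem_convexHull
  rw [Metric.mem_closedBall, dist_comm] at h2
  have h3 := pow_le_pow_left₀ dist_nonneg h2 2
  rw [Real.sq_sqrt hb] at h3
  have h4 := hcb x
  rw [excess_apply, parabola]
  linarith

lemma convexHull_insert_subset :
    convexHull ℝ ((insert x S : Finset (Pt d)) : Set (Pt d)) ⊆ convexHull ℝ (S : Set (Pt d)) := by
  refine convexHull_min (fun y hy => ?_) (convex_convexHull ℝ _)
  rcases Finset.mem_insert.1 (Finset.mem_coe.1 hy) with rfl | hy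
  · exact convexHull_mono (Finset.coe_subset.2 h.subset) h.mem_convexHull
  · exact subset_convexHull ℝ _ hy

/-- Subdividing the simplex `s` at the new point gives a regular triangulation: the lifted new
point lies slightly below the lifted simplex. -/
lemma isRegularTriangulation : IsRegularTriangulation (insert x S)
    ((t \ circuitCells (insert x s) (insertionCircuit s x)) ∪
      circuitCells (insert x s) (-insertionCircuit s x)) := by
  obtain ⟨w, hw⟩ := h.regular.exists_weights
  have hs := hw s h.mem
  set w' := Function.update w x (interp s w x) with hw'
  have hne : ∀ q ∈ S, q ≠ x := fun q hq hqx => h.notMem (hqx ▸ hq)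
  have hw'S : ∀ q ∈ S, w' q = w q := fun q hq => Function.update_of_ne (hne q hq) _ _
  refine h.isCircuit.isRegularTriangulation_flip (w := w') (v := -Pi.single x 1) (h := interp s w)
    (Finset.insert_subset_insert x h.subset) ?_ ?_ ?_
    (h.convexHull_insert_subset.trans h.regular.1.cover.ge) ?_
  · intro z hz
    rcases Finset.mem_insert.1 hz with rfl | hz
    · rw [hw', Function.update_self]
    · rw [hw'S z (h.subset hz), hs.interp_of_mem w hz]
  · intro q hq hqs
    have hqx : q ≠ x := fun hqx => hqs (hqx ▸ Finset.mem_insert_self x s)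
    have hqS := Finset.mem_of_mem_insert_of_ne hq hqx
    rw [hw'S q hqS]
    exact hs.lt q hqS fun hq => hqs (Finset.mem_insert_of_mem hq)
  · rw [Finset.sum_eq_single x]
    · simp [insertionCircuit]
    · intro z _ hzx
      simp [hzx]
    · exact fun hx => absurd (Finset.mem_insert_self x s) hx
  · intro T hT hTs
    rw [h.circuitCells_eq, Finset.mem_singleton] at hTs
    have hTw := hw T hT
    have hint : interp T w' = interp T w := interp_congr fun p hp => hw'S p (hTw.subset hp)
    refine ⟨hTw.toIsSimplex, hTw.subset.trans (Finset.subset_insert x S), fun q hq hqT => ?_⟩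
    rw [hint]
    rcases Finset.mem_insert.1 hq with rfl | hq
    · rw [hw', Function.update_self]
      refine lt_of_le_of_ne (hs.interp_le_interp hTw h.mem_convexHull) fun heq => hTs ?_
      exact h.eq_of_mem_convexHull_inter hTw.card_eq (hs.mem_of_interp_eq hTw h.mem_convexHull heq)
    · rw [hw'S q hq]
      exact hTw.lt q hq hqT

lemma isFlip : IsFlip (insert x s) t
    ((t \ circuitCells (insert x s) (insertionCircuit s x)) ∪
      circuitCells (insert x s) (-insertionCircuit s x)) :=
  h.isCircuit.isFlip (by rw [h.circuitCells_eq]; exact Finset.singleton_subset_iff.2 h.mem)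

lemma vr_lt : Vr ((t \ circuitCells (insert x s) (insertionCircuit s x)) ∪
    circuitCells (insert x s) (-insertionCircuit s x)) < Vr t := by
  refine vr_sdiff_union_lt (by rw [h.circuitCells_eq]; exact Finset.singleton_subset_iff.2 h.mem)
    (h.isCircuit.vr_lt ?_)
  have := h.sum_mul_eq_excess (parabola d)
  simp only [parabola] at this
  rw [this]
  exact h.excess_parabola_neg

/-- The subdivision of `s` at `x` is the only flip on `s` and `x`. -/
lemma eq_of_isFlip {t' : Cells d} (hflip : IsFlip (insert x s) t t') :
    t' = (t \ circuitCells (insert x s) (insertionCircuit s x)) ∪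
      circuitCells (insert x s) (-insertionCircuit s x) := by
  obtain ⟨-, t₁, t₂, hsub, ht₁, ht₂, hne, rfl⟩ := hflip
  have h₁ : t₁ = {s} := by
    refine Finset.eq_singleton_iff_nonempty_unique_mem.2 ⟨?_, fun T hT => ?_⟩
    · by_contra hemp
      have hc := ht₁.cover
      rw [Finset.not_nonempty_iff_eq_empty.1 hemp] at hc
      have hx : x ∈ convexHull ℝ ((insert x s : Finset (Pt d)) : Set (Pt d)) :=
        subset_convexHull ℝ _ (Finset.mem_coe.2 (Finset.mem_insert_self x s))
      rw [← hc] at hx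
      simp at hx
    · refine Finset.eq_of_subset_of_card_le (fun p hp => ?_) (by
        rw [ht₁.card_eq T hT, h.isSimplex.card_eq])
      refine Finset.mem_of_mem_insert_of_ne (ht₁.subset T hT hp) fun hpx => h.notMem ?_
      exact hpx ▸ h.regular.1.subset T (hsub hT) hp
  have hsub₂ : t₂ ⊆ circuitCells (insert x s) (-insertionCircuit s x) := by
    have hs₂ : s ∉ t₂ := by
      intro hs
      refine hne (h₁.trans (Finset.eq_singleton_iff_unique_mem.2 ⟨hs, fun T hT => ?_⟩).symm)
      by_cases hxT : x ∈ T
      · refine h.eq_of_mem_convexHull_inter (ht₂.card_eq T hT) ?_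
        rw [← ht₂.inter_eq s hs T hT]
        exact ⟨h.mem_convexHull, subset_convexHull ℝ _ hxT⟩
      · exact Finset.eq_of_subset_of_card_le (fun p hp => Finset.mem_of_mem_insert_of_ne
          (ht₂.subset T hT hp) fun hpx => hxT (hpx ▸ hp)) (by
            rw [ht₂.card_eq T hT, h.isSimplex.card_eq])
    intro T hT
    have hcard : (insert x s \ T).card = 1 := by
      rw [Finset.card_sdiff_of_subset (ht₂.subset T hT), ht₂.card_eq T hT, h.isCircuit.card_eq]
      omega
    obtain ⟨p, hp⟩ := Finset.card_eq_one.1 hcard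
    have hTp : (insert x s).erase p = T := by
      rw [← Finset.sdiff_singleton_eq_erase, ← hp, Finset.sdiff_sdiff_eq_self (ht₂.subset T hT)]
    have hpZ : p ∈ insert x s := (Finset.mem_sdiff.1 (hp ▸ Finset.mem_singleton_self p)).1
    refine mem_circuitCells.2 ⟨p, hpZ, ?_, hTp⟩
    have hpx : p ≠ x := by
      rintro rfl
      rw [Finset.erase_insert h.notMem_cell] at hTp
      exact hs₂ (hTp ▸ hT)
    rw [Pi.neg_apply, insertionCircuit, if_neg hpx, neg_neg]
    exact h.bary_pos (Finset.mem_of_mem_insert_of_ne hpZ hpx)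
  have hpos : 0 < ∑ z ∈ insert x s, (-insertionCircuit s x) z * (-insertionCircuit s x) z := by
    obtain ⟨p, hp, hpl⟩ := h.isCircuit.neg.exists_pos
    exact Finset.sum_pos' (fun z _ => mul_self_nonneg _) ⟨p, hp, mul_pos hpl hpl⟩
  have h₂ : t₂ = circuitCells (insert x s) (-insertionCircuit s x) := by
    refine Finset.Subset.antisymm hsub₂ fun T hT => mem_of_isLowerCell (fun T hT =>
      h.isCircuit.neg.isLowerCell hpos (hsub₂ hT)) ht₂.cover.ge
      (h.isCircuit.neg.isLowerCell hpos hT)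
  rw [h₁, h₂, h.circuitCells_eq]

end IsInsertion

/-! ### Runs of the algorithm -/

section Runs

variable {n : ℕ} {A : Finset (Pt d)} {x : Fin n → Pt d}

lemma pointSet_zero (A : Finset (Pt d)) (x : Fin n → Pt d) : pointSet A x 0 = A := by
  simp [pointSet]

lemma pointSet_succ (A : Finset (Pt d)) (x : Fin n → Pt d) (j : Fin n) :
    pointSet A x (j + 1) = insert (x j) (pointSet A x j) := by
  have : (Finset.univ.filter fun k : Fin n => (k : ℕ) < j + 1) =
      insert j (Finset.univ.filter fun k : Fin n => (k : ℕ) < j) := by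
    ext k
    simp only [Finset.mem_filter, Finset.mem_univ, true_and, Finset.mem_insert, Fin.ext_iff]
    omega
  rw [pointSet, this, Finset.image_insert, Finset.union_insert, pointSet]

lemma pointSet_self (A : Finset (Pt d)) (x : Fin n → Pt d) :
    pointSet A x n = A ∪ Finset.univ.image x := by
  simp [pointSet]

lemma pointSet_subset (A : Finset (Pt d)) (x : Fin n → Pt d) (i : ℕ) :
    pointSet A x i ⊆ pointSet A x n := by
  rw [pointSet_self, pointSet]
  exact Finset.union_subset_union_right (Finset.image_subset_image (Finset.filter_subset _ _))

lemma subset_pointSet (A : Finset (Pt d)) (x : Fin n → Pt d) (i : ℕ) : A ⊆ pointSet A x i :=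
  Finset.subset_union_left

namespace IsArtificialSimplex

lemma generalPosition_pointSet (hA : IsArtificialSimplex A x) (i : ℕ) :
    GeneralPosition (pointSet A x i) := hA.generalPosition.mono (pointSet_subset A x i)

lemma notMem_pointSet (hA : IsArtificialSimplex A x) (j : Fin n) : x j ∉ pointSet A x j := by
  intro h
  rcases Finset.mem_union.1 h with h | h
  · exact hA.notMem j h
  · obtain ⟨k, hk, hkj⟩ := Finset.mem_image.1 h
    rw [hA.injective hkj] at hk
    simp at hk

lemma isInsertion (hA : IsArtificialSimplex A x) {j : Fin n} {t : Cells d}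
    (ht : IsRegularTriangulation (pointSet A x j) t) {s : Finset (Pt d)} (hs : s ∈ t)
    (hx : x j ∈ convexHull ℝ (s : Set (Pt d))) : IsInsertion (pointSet A x j) t s (x j) :=
  ⟨by rw [← pointSet_succ]; exact hA.generalPosition_pointSet _, hA.notMem_pointSet j, ht, hs, hx⟩

lemma isRegularTriangulation_singleton (hA : IsArtificialSimplex A x) :
    IsRegularTriangulation A {A} := by
  have hs : IsSimplex A := hA.generalPosition.affinelyGeneric.isSimplex
    (subset_pointSet A x n) hA.card_eq
  refine isRegularTriangulation_of_isLowerCell (w := 0) (fun T hT => ?_) (by simp)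
  rw [Finset.mem_singleton.1 hT]
  exact ⟨hs, subset_rfl, fun q hq hqA => absurd hq hqA⟩

/-- A step preserves regularity; a flip decreases the functional, and only the treatment of a new
point changes the point set. -/
lemma step (hA : IsArtificialSimplex A x) {c c' : State d} (hi : c.i ≤ n)
    (hc : IsRegularTriangulation (pointSet A x c.i) c.tri) (hstep : Step A x c c') :
    c'.i ≤ n ∧ IsRegularTriangulation (pointSet A x c'.i) c'.tri ∧
      (c'.i = c.i + 1 ∨ c'.i = c.i ∧ Vr c'.tri < Vr c.tri) := by
  rcases hstep with ⟨_, _, h⟩ | ⟨j, t, _, hlot⟩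
  · rcases h with ⟨i, t, t', h⟩ | ⟨j, t, t', s, _, _, hs, hx, hflip⟩
    · exact ⟨hi, h.2.1, Or.inr ⟨rfl, h.2.2⟩⟩
    · have hins := hA.isInsertion hc hs hx
      refine ⟨j.2, ?_, Or.inl rfl⟩
      simp only [pointSet_succ]
      rw [hins.eq_of_isFlip hflip]
      exact hins.isRegularTriangulation
  · exact ⟨j.2, hlot.1, Or.inl rfl⟩

lemma vr_lt_of_flipStep (hA : IsArtificialSimplex A x) {c c' : State d}
    (hc : IsRegularTriangulation (pointSet A x c.i) c.tri) (hstep : FlipStep A x c c') :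
    Vr c'.tri < Vr c.tri := by
  rcases hstep with ⟨i, t, t', h⟩ | ⟨j, t, t', s, _, _, hs, hx, hflip⟩
  · exact h.2.2
  · have hins := hA.isInsertion hc hs hx
    simp only
    rw [hins.eq_of_isFlip hflip]
    exact hins.vr_lt

lemma reachable (hA : IsArtificialSimplex A x) {c : State d} (hc : Reachable A x c) :
    c.i ≤ n ∧ IsRegularTriangulation (pointSet A x c.i) c.tri := by
  induction hc with
  | refl =>
    refine ⟨Nat.zero_le n, ?_⟩
    simp only [initState, pointSet_zero]
    exact hA.isRegularTriangulation_singleton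
  | tail _ hstep ih => exact ⟨(hA.step ih.1 ih.2 hstep).1, (hA.step ih.1 ih.2 hstep).2.1⟩

lemma eq_delaunay (hA : IsArtificialSimplex A x) {c : State d} (hc : Reachable A x c)
    (hend : LoopEnded A x c) : c.tri = delaunay (pointSet A x c.i) :=
  IsLOT.eq_delaunay (hA.generalPosition_pointSet c.i) ⟨(hA.reachable hc).2, hend⟩

lemma exists_step_or_isFinal (hA : IsArtificialSimplex A x) {c : State d}
    (hc : Reachable A x c) : (∃ c' : State d, Step A x c c') ∨ IsFinal A x c := by
  obtain ⟨hi, hreg⟩ := hA.reachable hc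
  obtain ⟨i, t⟩ := c
  by_cases hend : LoopEnded A x ⟨i, t⟩
  · rcases hi.eq_or_lt with heq | hlt
    · exact Or.inr ⟨heq, hend⟩
    · left
      obtain ⟨j, rfl⟩ : ∃ j : Fin n, (j : ℕ) = i := ⟨⟨i, hlt⟩, rfl⟩
      by_cases hlot : IsLOT (pointSet A x (j + 1)) t
      · exact ⟨_, .skip j t hend hlot⟩
      · have hx := convexHull_mono (𝕜 := ℝ) (Finset.coe_subset.2 (subset_pointSet A x j))
          (hA.mem_convexHull j)
        rw [← hreg.1.cover] at hx
        simp only [Set.mem_iUnion] at hx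
        obtain ⟨s, hs, hxs⟩ := hx
        exact ⟨_, .flip _ _ (.insert j t _ s hend hlot hs hxs (hA.isInsertion hreg hs hxs).isFlip)⟩
  · left
    obtain ⟨t', ht'⟩ := not_not.1 hend
    exact ⟨_, .flip _ _ (.improve i t t' ht')⟩

/-- The runs are finite, since a lexicographic measure decreases: the number of points to be
treated, and then the number of cell collections with smaller functional. -/
lemma not_exists_infinite_run (hA : IsArtificialSimplex A x) :
    ¬ ∃ run : ℕ → State d, run 0 = initState A ∧ ∀ k, Step A x (run k) (run (k + 1)) := by
  rintro ⟨run, h0, hstep⟩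
  have hreach : ∀ k, Reachable A x (run k) := by
    intro k
    induction k with
    | zero => rw [h0]; exact Relation.ReflTransGen.refl
    | succ k ih => exact ih.tail (hstep k)
  let U : Finset (Cells d) := (pointSet A x n).powerset.powerset
  let m : State d → ℕ := fun c =>
    (n - c.i) * (U.card + 1) + (U.filter fun u => Vr u < Vr c.tri).card
  have hanti : StrictAnti fun k => m (run k) := by
    refine strictAnti_nat_of_succ_lt fun k => ?_
    obtain ⟨hi, hreg⟩ := hA.reachable (hreach k)
    obtain ⟨hi', hreg', hcase⟩ := hA.step hi hreg (hstep k)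
    rcases hcase with hcase | ⟨hcase, hlt⟩
    · have h1 : n - (run k).i = n - (run (k + 1)).i + 1 := by omega
      have h2 := Finset.card_filter_le U fun u => Vr u < Vr (run (k + 1)).tri
      simp only [m]
      rw [h1, add_mul, one_mul]
      omega
    · simp only [m]
      rw [hcase]
      refine Nat.add_lt_add_left (Finset.card_lt_card (Finset.ssubset_iff_subset_ne.2
        ⟨fun u hu => ?_, fun heq => ?_⟩)) _
      · exact Finset.mem_filter.2 ⟨(Finset.mem_filter.1 hu).1, (Finset.mem_filter.1 hu).2.trans hlt⟩
      · have hmem : (run (k + 1)).tri ∈ U := Finset.mem_powerset.2 fun T hT =>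
          Finset.mem_powerset.2 ((hreg'.1.subset T hT).trans (pointSet_subset A x _))
        have : (run (k + 1)).tri ∈ U.filter fun u => Vr u < Vr (run k).tri :=
          Finset.mem_filter.2 ⟨hmem, hlt⟩
        rw [← heq] at this
        exact (Finset.mem_filter.1 this).2.false
  exact not_strictAnti_of_wellFoundedLT _ hanti

end IsArtificialSimplex

/-- If the artificial points are far away, then the output is the Delaunay triangulation: the
circumscribed balls of the Delaunay simplices contain no artificial point. -/
lemma exists_radius_output_eq (x : Fin n → Pt d) :
    ∃ R : ℝ, ∀ A : Finset (Pt d), IsArtificialSimplex A x → (∀ a ∈ A, R < ‖a‖) →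
      ∀ c : State d, Reachable A x c → IsFinal A x c →
        output A c.tri = delaunay (Finset.univ.image x) := by
  set S := Finset.univ.image x
  have hcentre : ∀ T : Finset (Pt d), ∃ c : Pt d,
      T ∈ delaunay S → ∀ p ∈ T, c ∈ voronoiCell S p := by
    intro T
    by_cases hT : T ∈ delaunay S
    · obtain ⟨c, hc⟩ := (Finset.mem_filter.1 hT).2
      exact ⟨c, fun _ => hc⟩
    · exact ⟨0, fun h => absurd h hT⟩
  choose cen hcen using hcentre
  refine ⟨∑ T ∈ delaunay S, (‖cen T‖ + ∑ p ∈ S, dist (cen T) p), fun A hA hR c hc hfin => ?_⟩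
  rw [hA.eq_delaunay hc hfin.2, hfin.1, pointSet_self]
  ext T
  rw [output, Finset.mem_filter]
  constructor
  · rintro ⟨hT, hdisj⟩
    obtain ⟨hT, c, hc⟩ := Finset.mem_filter.1 hT
    obtain ⟨hTS, hcard⟩ := Finset.mem_powersetCard.1 hT
    refine Finset.mem_filter.2 ⟨Finset.mem_powersetCard.2 ⟨fun p hp => ?_, hcard⟩, c,
      fun p hp q hq => hc p hp q (Finset.mem_union_right _ hq)⟩
    exact (Finset.mem_union.1 (hTS hp)).resolve_left (Finset.disjoint_left.1 hdisj hp)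
  · intro hT
    obtain ⟨hTS, hcard⟩ := Finset.mem_powersetCard.1 (Finset.mem_filter.1 hT).1
    refine ⟨Finset.mem_filter.2 ⟨Finset.mem_powersetCard.2
      ⟨hTS.trans Finset.subset_union_right, hcard⟩, cen T, fun p hp q hq => ?_⟩, ?_⟩
    · rcases Finset.mem_union.1 hq with hq | hq
      · have h1 : ‖cen T‖ + ∑ p ∈ S, dist (cen T) p < ‖q‖ := lt_of_le_of_lt
          (Finset.single_le_sum (f := fun T => ‖cen T‖ + ∑ p ∈ S, dist (cen T) p)
            (fun T _ => add_nonneg (norm_nonneg _) (Finset.sum_nonneg fun _ _ => dist_nonneg)) hT)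
          (hR q hq)
        have h2 : dist (cen T) p ≤ ∑ p ∈ S, dist (cen T) p :=
          Finset.single_le_sum (f := fun p => dist (cen T) p) (fun _ _ => dist_nonneg) (hTS hp)
        have h3 : ‖q‖ ≤ ‖cen T‖ + dist (cen T) q := by
          rw [dist_eq_norm, norm_sub_rev]
          exact norm_le_norm_add_norm_sub' q (cen T)
        linarith
      · exact hcen T hT p hp q hq
    · refine Finset.disjoint_left.2 fun p hp hpA => ?_
      obtain ⟨j, -, rfl⟩ := Finset.mem_image.1 (hTS hp)
      exact hA.notMem j hpA

end Runs

/-! ### Existence of artificial simplices -/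

/-- A finite set of points in general position can be extended by a point of any nonempty open
set: the points to be avoided lie in finitely many hyperplanes and spheres. -/
lemma GeneralPosition.exists_insert (hd : 0 < d) {S : Finset (Pt d)} (hS : GeneralPosition S)
    {U : Set (Pt d)} (hU : IsOpen U) (hne : U.Nonempty) :
    ∃ a ∈ U, a ∉ S ∧ GeneralPosition (insert a S) := by
  have : Nonempty (Fin d) := ⟨⟨0, hd⟩⟩
  let N₁ : Set (Pt d) := ⋃ T ∈ S.powerset.filter fun T => T.card ≤ d,
    (affineSpan ℝ (T : Set (Pt d)) : Set (Pt d))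
  let N₂ : Set (Pt d) := ⋃ T ∈ S.powerset.filter fun T => IsSimplex T,
    {a | excess T a (parabola d) = 0}
  have h₁ : MeasureTheory.volume N₁ = 0 := by
    refine (MeasureTheory.measure_biUnion_null_iff (Finset.countable_toSet _)).2 fun T hT => ?_
    obtain ⟨hTS, hc⟩ := Finset.mem_filter.1 (Finset.mem_coe.1 hT)
    refine MeasureTheory.Measure.addHaar_affineSubspace _ _ fun htop => ?_
    have hind := hS.affineIndependent T (Finset.mem_powerset.1 hTS) (by omega)
    have := hind.affineSpan_eq_top_iff_card_eq_finrank_add_one.1 (by simpa using htop)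
    simp at this
    omega
  have h₂ : MeasureTheory.volume N₂ = 0 := by
    refine (MeasureTheory.measure_biUnion_null_iff (Finset.countable_toSet _)).2 fun T _ => ?_
    obtain ⟨c, b, hcb⟩ := exists_center (interp T (parabola d))
    refine MeasureTheory.measure_mono_null (fun a ha => ?_)
      (MeasureTheory.Measure.addHaar_sphere _ c (√b))
    have h1 := hcb a
    have h2 : ‖a‖ ^ 2 - interp T (parabola d) a = 0 := ha
    rw [Metric.mem_sphere, dist_comm, ← show dist c a ^ 2 = b by linarith, Real.sqrt_sq dist_nonneg]
  have hpos := hU.measure_pos MeasureTheory.volume hne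
  obtain ⟨a, haU, ha⟩ : ∃ a ∈ U, a ∉ N₁ ∪ N₂ := by
    by_contra! hsub
    exact hpos.ne' (MeasureTheory.measure_mono_null hsub (MeasureTheory.measure_union_null h₁ h₂))
  rw [Set.mem_union, not_or] at ha
  have ha₁ : ∀ T ⊆ S, T.card ≤ d → a ∉ affineSpan ℝ (T : Set (Pt d)) := fun T hT hc h =>
    ha.1 (Set.mem_biUnion (Finset.mem_coe.2 (Finset.mem_filter.2 ⟨Finset.mem_powerset.2 hT, hc⟩)) h)
  have ha₂ : ∀ T ⊆ S, IsSimplex T → excess T a (parabola d) ≠ 0 := fun T hT hs h =>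
    ha.2 (Set.mem_biUnion (Finset.mem_coe.2 (Finset.mem_filter.2 ⟨Finset.mem_powerset.2 hT, hs⟩)) h)
  refine ⟨a, haU, fun haS => ?_, fun T hT hc => ?_, fun T hT hc hcos => ?_⟩
  · exact ha₁ {a} (Finset.singleton_subset_iff.2 haS) (by
      rw [Finset.card_singleton]; exact hd) (subset_affineSpan ℝ _ (by simp))
  · by_cases haT : a ∈ T
    · have hsub : T.erase a ⊆ S := Finset.subset_insert_iff.1 hT
      have hcard : (T.erase a).card ≤ d := by rw [Finset.card_erase_of_mem haT]; omega
      have hind := hS.affineIndependent _ hsub (by omega)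
      refine AffineIndependent.affineIndependent_of_notMem_span (i := ⟨a, haT⟩) ?_ ?_
      · exact hind.comp_embedding (⟨fun y => ⟨y.1.1, Finset.mem_erase.2
          ⟨fun h => y.2 (Subtype.ext h), y.1.2⟩⟩, fun y z h =>
            Subtype.ext (Subtype.ext (Subtype.mk.inj h))⟩ :
          {y : {p : Pt d // p ∈ T} // y ≠ ⟨a, haT⟩} ↪ {p : Pt d // p ∈ T.erase a})
      · refine fun h => ha₁ _ hsub hcard (affineSpan_mono ℝ ?_ h)
        rintro _ ⟨y, hy, rfl⟩
        exact Finset.mem_coe.2 (Finset.mem_erase.2 ⟨fun h => hy (Subtype.ext h), y.2⟩)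
    · exact hS.affineIndependent T (fun p hp => Finset.mem_of_mem_insert_of_ne (hT hp)
        fun h => haT (h ▸ hp)) hc
  · by_cases haT : a ∈ T
    · have hsub : T.erase a ⊆ S := Finset.subset_insert_iff.1 hT
      have hs : IsSimplex (T.erase a) := hS.affinelyGeneric.isSimplex hsub (by
        rw [Finset.card_erase_of_mem haT, hc]; rfl)
      obtain ⟨c, r, hr⟩ := hcos
      obtain ⟨g, hg⟩ := exists_affine_of_sphere c (r ^ 2)
      have hgT : ∀ y ∈ T, g y = parabola d y := fun y hy => by
        have h1 := hg y
        rw [dist_comm, hr y (Finset.mem_coe.2 hy), sub_self] at h1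
        exact (sub_eq_zero.1 h1).symm
      refine ha₂ _ hsub hs ?_
      rw [excess_apply, hs.interp_eq fun y hy => hgT y (Finset.mem_of_mem_erase hy), hgT a haT,
        sub_self]
    · exact hS.not_cospherical T (fun p hp => Finset.mem_of_mem_insert_of_ne (hT hp)
        fun h => haT (h ▸ hp)) hc hcos

lemma GeneralPosition.exists_perturbation (hd : 0 < d) {S : Finset (Pt d)}
    (hS : GeneralPosition S) {k : ℕ} (a : Fin k → Pt d) :
    ∃ b : Fin k → Pt d, (∀ i, dist (b i) (a i) < 1) ∧ Function.Injective b ∧ (∀ i, b i ∉ S) ∧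
      GeneralPosition (Finset.univ.image b ∪ S) := by
  induction k with
  | zero => exact ⟨a, fun i => i.elim0, fun i => i.elim0, fun i => i.elim0, by simpa using hS⟩
  | succ k ih =>
    obtain ⟨b, hdist, hinj, hnot, hgp⟩ := ih (Fin.tail a)
    obtain ⟨p, hp, hpnot, hpgp⟩ := hgp.exists_insert hd (Metric.isOpen_ball (x := a 0) (ε := 1))
      ⟨a 0, Metric.mem_ball_self one_pos⟩
    rw [Finset.mem_union, not_or] at hpnot
    refine ⟨Fin.cons p b, Fin.cases hp hdist, Fin.cons_injective_iff.2 ⟨?_, hinj⟩,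
      Fin.cases hpnot.2 hnot, ?_⟩
    · rintro ⟨i, rfl⟩
      exact hpnot.1 (Finset.mem_image_of_mem b (Finset.mem_univ i))
    · have : Finset.univ.image (Fin.cons p b : Fin (k + 1) → Pt d) =
          insert p (Finset.univ.image b) := by
        ext y
        simp [Fin.exists_fin_succ, eq_comm]
      rw [this, Finset.insert_union]
      exact hpgp

/-- If the hull of finitely many points contains a ball, then after moving each of them by less
than `1` it contains the concentric ball with radius smaller by `1`. -/
lemma closedBall_subset_convexHull_of_dist_lt {ι : Type*} [Finite ι] {a b : ι → Pt d} {M : ℝ}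
    (hM : 0 ≤ M) (ha : Metric.closedBall 0 (M + 1) ⊆ convexHull ℝ (Set.range a))
    (hab : ∀ i, dist (b i) (a i) < 1) :
    Metric.closedBall 0 M ⊆ convexHull ℝ (Set.range b) := by
  intro x hx
  by_contra hxb
  obtain ⟨f, u, hfu, hux⟩ := geometric_hahn_banach_closed_point (convex_convexHull ℝ _)
    ((Set.finite_range b).isClosed_convexHull ℝ) hxb
  set v := (InnerProductSpace.toDual ℝ (Pt d)).symm f with hv
  have hf : ∀ y, f y = inner ℝ v y := fun y => by
    rw [hv, InnerProductSpace.toDual_symm_apply]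
  have hfle : ∀ y, f y ≤ ‖v‖ * ‖y‖ := fun y => by rw [hf]; exact real_inner_le_norm v y
  have hxM : ‖x‖ ≤ M := by simpa using hx
  have hfx : f x ≤ ‖v‖ * M := (hfle x).trans (mul_le_mul_of_nonneg_left hxM (norm_nonneg v))
  -- All vertices `a i` lie strictly below the value of `f` at a point of the large ball.
  have hai : ∀ i, f (a i) < f x + ‖v‖ := by
    intro i
    have h1 := hfu (b i) (subset_convexHull ℝ _ ⟨i, rfl⟩)
    have h2 := hfle (a i - b i)
    rw [map_sub, ← dist_eq_norm, dist_comm] at h2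
    have h3 := mul_le_mul_of_nonneg_left (hab i).le (norm_nonneg v)
    linarith
  have hhull : convexHull ℝ (Set.range a) ⊆ {y | f y < f x + ‖v‖} := by
    refine convexHull_min ?_ (convex_halfSpace_lt f.toLinearMap.isLinear _)
    rintro _ ⟨i, rfl⟩
    exact hai i
  rcases eq_or_ne v 0 with h0 | h0
  · have h1 := hhull (ha (show (0 : Pt d) ∈ Metric.closedBall 0 (M + 1) by simp; linarith))
    simp only [Set.mem_ofPred_eq, hf, h0, inner_zero_left, norm_zero, add_zero,
      lt_self_iff_false] at h1
  · have hn : 0 < ‖v‖ := norm_pos_iff.2 h0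
    have h1 := hhull (ha (show ((M + 1) / ‖v‖) • v ∈ Metric.closedBall 0 (M + 1) by
      rw [mem_closedBall_zero_iff, norm_smul, Real.norm_of_nonneg (by positivity),
        div_mul_cancel₀ _ hn.ne']))
    simp only [Set.mem_ofPred_eq] at h1
    rw [hf, inner_smul_right, real_inner_self_eq_norm_sq] at h1
    have h2 : (M + 1) / ‖v‖ * ‖v‖ ^ 2 = (M + 1) * ‖v‖ := by field_simp
    rw [h2] at h1
    linarith

open scoped Pointwise in
/-- There are simplices with vertices far away whose hulls contain large balls. -/
lemma exists_large_simplex (hd : 0 < d) (M r : ℝ) :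
    ∃ a : Fin (Module.finrank ℝ (Pt d) + 1) → Pt d,
      Metric.closedBall 0 M ⊆ convexHull ℝ (Set.range a) ∧ ∀ i, r < ‖a i‖ := by
  obtain ⟨e, he, -⟩ := exists_mem_interior_convexHull_affineBasis (x := (0 : Pt d)) univ_mem
  -- As `d` is positive, a vertex is not an interior point of the simplex.
  have hne : ∀ i, e i ≠ 0 := by
    intro i h0
    rw [e.interior_convexHull] at he
    have : Nontrivial (Fin (Module.finrank ℝ (Pt d) + 1)) := by
      rw [Fin.nontrivial_iff_two_le, finrank_euclideanSpace_fin]; omega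
    obtain ⟨j, hj⟩ := exists_ne i
    have h1 : 0 < e.coord j 0 := he j
    rw [← h0, e.coord_apply_ne hj] at h1
    exact h1.false
  obtain ⟨δ, hδ, hball⟩ := Metric.nhds_basis_closedBall.mem_iff.1 (mem_interior_iff_mem_nhds.1 he)
  have hev : ∀ᶠ N in atTop, 0 < N ∧ M ≤ N * δ ∧ ∀ i, r < N * ‖e i‖ := by
    refine (eventually_gt_atTop (0 : ℝ)).and (((tendsto_id.atTop_mul_const hδ).eventually_ge_atTop
      M).and (eventually_all.2 fun i => ?_))
    exact (tendsto_id.atTop_mul_const (norm_pos_iff.2 (hne i))).eventually_gt_atTop r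
  obtain ⟨N, hN, hNM, hNr⟩ := hev.exists
  refine ⟨fun i => N • e i, fun x hx => ?_, fun i => ?_⟩
  · have hrange : Set.range (fun i => N • e i) = N • Set.range e := by
      rw [← Set.image_smul, ← Set.range_comp]; rfl
    rw [hrange, convexHull_smul, Set.mem_smul_set_iff_inv_smul_mem₀ hN.ne']
    refine hball ?_
    rw [mem_closedBall_zero_iff] at hx ⊢
    rw [norm_smul, norm_inv, Real.norm_of_nonneg hN.le, inv_mul_le_iff₀ hN]
    linarith
  · rw [norm_smul, Real.norm_of_nonneg hN.le]
    exact hNr i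

lemma exists_isArtificialSimplex (hd : 0 < d) {n : ℕ} {x : Fin n → Pt d}
    (hx : Function.Injective x) (hS : GeneralPosition (Finset.univ.image x)) (r : ℝ) :
    ∃ A : Finset (Pt d), IsArtificialSimplex A x ∧ ∀ a ∈ A, r < ‖a‖ := by
  set M := ∑ j, ‖x j‖
  obtain ⟨a, ha, har⟩ := exists_large_simplex hd (M + 1) (r + 1)
  obtain ⟨b, hdist, hinj, hnot, hgp⟩ := hS.exists_perturbation hd a
  have hball := closedBall_subset_convexHull_of_dist_lt
    (Finset.sum_nonneg fun j _ => norm_nonneg (x j)) ha hdist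
  refine ⟨Finset.univ.image b, ⟨?_, fun j => ?_, hx, fun j hj => ?_, ?_⟩, fun p hp => ?_⟩
  · rw [Finset.card_image_of_injective _ hinj, Finset.card_univ, Fintype.card_fin,
      finrank_euclideanSpace_fin]
  · have := hball (mem_closedBall_zero_iff.2
      (Finset.single_le_sum (f := fun j => ‖x j‖) (fun j _ => norm_nonneg (x j))
        (Finset.mem_univ j)))
    simpa using this
  · obtain ⟨i, -, hi⟩ := Finset.mem_image.1 hj
    exact hnot i (hi ▸ Finset.mem_image_of_mem x (Finset.mem_univ j))
  · rw [pointSet_self]; exact hgp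
  · obtain ⟨i, -, rfl⟩ := Finset.mem_image.1 hp
    have h1 := har i
    have h2 := hdist i
    rw [dist_comm, dist_eq_norm] at h2
    have h3 := norm_le_norm_add_norm_sub' (a i) (b i)
    linarith

end IncrementalFlip

open IncrementalFlip in
theorem theorem5 (d : ℕ) (hd : 0 < d) :
    -- a locally optimal triangulation is the Delaunay triangulation
    (∀ (S : Finset (Pt d)) (t : Cells d), GeneralPosition S → IsLOT S t → t = delaunay S) ∧
    -- the incremental algorithm: behaviour of every run
    (∀ (n : ℕ) (x : Fin n → Pt d) (A : Finset (Pt d)), IsArtificialSimplex A x →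
      (∀ c : State d, Reachable A x c →
        IsRegularTriangulation (pointSet A x c.i) c.tri ∧
        (∀ c' : State d, FlipStep A x c c' → Vr c'.tri < Vr c.tri) ∧
        ((∃ c' : State d, Step A x c c') ∨ IsFinal A x c) ∧
        (LoopEnded A x c → c.tri = delaunay (pointSet A x c.i))) ∧
      (¬ ∃ run : ℕ → State d, run 0 = initState A ∧ ∀ k, Step A x (run k) (run (k + 1)))) ∧
    -- with artificial points far away, which exist, the output is the Delaunay triangulation
    (∀ (n : ℕ) (x : Fin n → Pt d), Function.Injective x →
      GeneralPosition (Finset.univ.image x) →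
      (∀ r : ℝ, ∃ A : Finset (Pt d), IsArtificialSimplex A x ∧ ∀ a ∈ A, r < ‖a‖) ∧
      ∃ R : ℝ, ∀ A : Finset (Pt d), IsArtificialSimplex A x → (∀ a ∈ A, R < ‖a‖) →
        ∀ c : State d, Reachable A x c → IsFinal A x c →
          output A c.tri = delaunay (Finset.univ.image x)) := by
  refine ⟨fun S t hS ht => ht.eq_delaunay hS, fun n x A hA => ⟨fun c hc => ⟨(hA.reachable hc).2,
    fun c' => hA.vr_lt_of_flipStep (hA.reachable hc).2, hA.exists_step_or_isFinal hc,
    hA.eq_delaunay hc⟩, hA.not_exists_infinite_run⟩, fun n x hx hS =>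
    ⟨exists_isArtificialSimplex hd hx hS, exists_radius_output_eq x⟩⟩
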